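/- **Setting.** For a real matrix $M$ with singular values $\sigma_1\ge\sigma_2\ge\dots$ let $\|M\|_{S_p}=(\sum_i\sigma_i^p)^{1/p}$. For $x\in\mathbb R^d$ let $x^{\otimes 2}\in\mathbb R^{d^2}$ be its tensor square; vectors of $\mathbb R^{d^2}$ are identified with $d\times d$ matrices, so that $x^{\otimes2}$ is $xx^\top$. Let $\mathcal D$ be a probability distribution on the unit sphere of $\mathbb R^d$, let $\tau\ge 1$ and $k\in\mathbb N$, and suppose that $\mathcal D$ is $(k,\varepsilon)$-regularly spectral decodable with norm $\|\cdot\|_{S_p}$: there are $A\in\mathbb R^{k\times d^2}$ and $B\in\mathbb R^{d^2\times k}$ with $\|BA\|_{\mathrm{op}}\le\tau$ such that, with probability 1 over $x\sim\mathcal D$, $BAx^{\otimes2}=xx^\top+E$ with $\|E\|_{S_p}\le\varepsilon$. Consider the problem $$\min_R\ f(R)=\mathbb E_{x\sim\mathcal D}\big\|Rx^{\otimes2}-x^{\otimes2}\big\|_{S_p}^2\quad\text{subject to}\quad \|R\|_{S_1}\le\tau k,\qquad R\in\mathbb R^{d^2\times d^2}.$$ The (usual) Frank–Wolfe algorithm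 starts at any feasible $R_0$ and sets $R_{t+1}=(1-\gamma_t)R_t+\gamma_tV_t$ with $\gamma_t=\frac{2}{t+2}$, where $V_t=\tau k\,uv^\top$ ($u,v$ unit vectors) minimizes $V\mapsto\langle\nabla f(R_t),V\rangle$ over $\|V\|_{S_1}\le\tau k$. **Theorem.** Let $p\ge 2$ be bounded, $p=O(1)$: for every $P$ there is a constant $C>0$, depending only on $P$, such that the following holds for all $p\in[2,P]$ and all $d,k,\tau,\varepsilon,\mathcal D$ as above. Runs of the Frank–Wolfe algorithm exist, and for every run, every $\delta>0$ and every integer $k'\ge C\,k^2\tau^2/\delta^2$, the iterate $\hat R=R_{k'}$ after $k'$ steps satisfies $$\operatorname{rank}\hat R\le k',\qquad \|\hat R\|_{S_1}\le\tau k,\qquad f(\hat R)\le\varepsilon^2+\delta^2,\qquad \mathbb E\big\|\hat Rx^{\otimes2}-x^{\otimes2}\big\|_{S_p}\le\varepsilon+\delta .$$ As a direct consequence there are $A\in\mathbb R^{k'\times d^2}$ and $B\in\mathbb R^{d^2\times k'}$ with $BA=\hat R$; they give spectral autoencoders of code length $k'$, with encoder $h(x)=Ax^{\otimes2}$ and decoder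 $g(y)=v_{\max}(By)$, where $v_{\max}(M)$ is a top right-singular (unit) vector of the matrix $M$. Such decoders exist, and whichever choices of the top right-singular vectors the decoder makes, the squared reconstruction error satisfies $$\mathbb E\,\min_{\pm}\big\|g(h(x))\pm x\big\|^2\le 8\,(\varepsilon^2+\delta^2).$$ In particular (take $\delta=\varepsilon>0$) a code length $k'=\lceil C\,k^2\tau^2/\varepsilon^2\rceil$ suffices for $f(\hat R)\le2\varepsilon^2$. -/

import Mathlib

open MeasureTheory
open scoped Matrix

noncomputable section

namespace SpectralAutoencoder

/-- The Schatten `p`-norm `(∑ σ_i(A)^p)^(1/p)` of a real matrix, used for `p ≥ 1`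
(`singularValues` is a finitely supported sequence). -/
def schattenNorm {m n : Type*} [Fintype m] [Fintype n] [DecidableEq m] [DecidableEq n]
    (p : ℝ) (A : Matrix m n ℝ) : ℝ :=
  ((Matrix.toEuclideanLin A).singularValues.sum fun _ s => s ^ p) ^ (1 / p)

/-- The tensor square `x ⊗ x`, a vector of dimension `d ^ 2` indexed by pairs. -/
def tensorSq {d : ℕ} (x : EuclideanSpace ℝ (Fin d)) : Fin d × Fin d → ℝ :=
  fun ij => x ij.1 * x ij.2

/-- A vector of dimension `d ^ 2` viewed as a `d × d` matrix, so that `u ⊗ v` becomes `u vᵀ`. -/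
def unlift {d : ℕ} (z : Fin d × Fin d → ℝ) : Matrix (Fin d) (Fin d) ℝ :=
  Matrix.of fun i j => z (i, j)

/-- The Schatten error `‖R x^{⊗2} - x^{⊗2}‖_{S_p}` of `R` at the data point `x`. -/
def schattenError {d : ℕ} (p : ℝ) (R : Matrix (Fin d × Fin d) (Fin d × Fin d) ℝ)
    (x : EuclideanSpace ℝ (Fin d)) : ℝ :=
  schattenNorm p (unlift (R *ᵥ tensorSq x - tensorSq x))

/-- The objective `f(R) = 𝔼 ‖R x^{⊗2} - x^{⊗2}‖_{S_p}^2`. -/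
def objective {d : ℕ} (p : ℝ) (μ : Measure (EuclideanSpace ℝ (Fin d)))
    (R : Matrix (Fin d × Fin d) (Fin d × Fin d) ℝ) : ℝ :=
  ∫ x, schattenError p R x ^ 2 ∂μ

/-- `μ` is `(k, ε)`-regularly spectral decodable with the Schatten `p`-norm and the operator
norm bound `τ`: there are `A ∈ ℝ^{k × d²}`, `B ∈ ℝ^{d² × k}` with `‖B A‖_op ≤ τ` such that, almost
surely, `B A x^{⊗2}` viewed as a matrix is `x xᵀ + E` with `‖E‖_{S_p} ≤ ε`. -/
def IsRegularlySpectralDecodable {d : ℕ} (p τ : ℝ) (k : ℕ) (ε : ℝ)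
    (μ : Measure (EuclideanSpace ℝ (Fin d))) : Prop :=
  ∃ (A : Matrix (Fin k) (Fin d × Fin d) ℝ) (B : Matrix (Fin d × Fin d) (Fin k) ℝ),
    ‖Matrix.toEuclideanCLM (𝕜 := ℝ) (B * A)‖ ≤ τ ∧
    ∀ᵐ x ∂μ, ∃ E : Matrix (Fin d) (Fin d) ℝ,
      unlift (B *ᵥ (A *ᵥ tensorSq x)) = Matrix.vecMulVec (fun i => x i) (fun i => x i) + E ∧
      schattenNorm p E ≤ ε

/-- `R 0, R 1, R 2, …` is a run of the usual Frank-Wolfe algorithm minimizing `f` over the ball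
`‖S‖_{S_1} ≤ r`: the start is any feasible point, and step `t` minimizes the differential of
`f` at `R t` over the ball, at an extreme point `r u vᵀ` (`u`, `v` unit vectors), and moves
towards that point with step size `2 / (t + 2)`. -/
structure IsFrankWolfeRun {n : Type*} [Fintype n] [DecidableEq n]
    (f : Matrix n n ℝ → ℝ) (r : ℝ) (R : ℕ → Matrix n n ℝ) : Prop where
  start : schattenNorm 1 (R 0) ≤ r
  step : ∀ t : ℕ, ∃ (G : Matrix n n ℝ →L[ℝ] ℝ) (u v : n → ℝ),
    HasFDerivAt f G (R t) ∧ u ⬝ᵥ u = 1 ∧ v ⬝ᵥ v = 1 ∧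
    (∀ S : Matrix n n ℝ, schattenNorm 1 S ≤ r → G (r • Matrix.vecMulVec u v) ≤ G S) ∧
    R (t + 1) = (1 - 2 / ((t : ℝ) + 2)) • R t
      + (2 / ((t : ℝ) + 2)) • (r • Matrix.vecMulVec u v)

/-- `v` is a top right-singular vector of `M`: a unit vector at which `‖M v‖` is maximal. -/
def IsTopRightSingularVector {d : ℕ} (M : Matrix (Fin d) (Fin d) ℝ)
    (v : EuclideanSpace ℝ (Fin d)) : Prop :=
  ‖v‖ = 1 ∧ ∀ w : EuclideanSpace ℝ (Fin d), ‖w‖ = 1 →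
    ‖Matrix.toEuclideanLin M w‖ ≤ ‖Matrix.toEuclideanLin M v‖

/-- The encoder `h_A(x) = A x^{⊗2}`. -/
def encoder {d k : ℕ} (A : Matrix (Fin k) (Fin d × Fin d) ℝ)
    (x : EuclideanSpace ℝ (Fin d)) : Fin k → ℝ :=
  A *ᵥ tensorSq x

/-- `g` is a spectral decoder `g_B(y) = v_max(B y)`, with any choice of the sign of the top
right-singular vector and any way of breaking ties. -/
def IsSpectralDecoder {d k : ℕ} (B : Matrix (Fin d × Fin d) (Fin k) ℝ)
    (g : (Fin k → ℝ) → EuclideanSpace ℝ (Fin d)) : Prop :=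
  ∀ y, IsTopRightSingularVector (unlift (B *ᵥ y)) (g y)

/-- The class of spectral autoencoders with code length `k`: pairs of an encoder `A x^{⊗2}` and
a decoder `v_max(B y)`. -/
def spectralAutoencoders (d k : ℕ) :
    Set ((EuclideanSpace ℝ (Fin d) → (Fin k → ℝ)) × ((Fin k → ℝ) → EuclideanSpace ℝ (Fin d))) :=
  {hg | ∃ (A : Matrix (Fin k) (Fin d × Fin d) ℝ) (B : Matrix (Fin d × Fin d) (Fin k) ℝ),
    hg.1 = encoder A ∧ IsSpectralDecoder B hg.2}

/-- The squared Euclidean reconstruction loss `‖g(h(x)) - x‖^2`, up to the sign of the output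
(`x` and `-x` have the same encoding, so the sign cannot be recovered). -/
def reconstructionLoss {d k : ℕ} (h : EuclideanSpace ℝ (Fin d) → (Fin k → ℝ))
    (g : (Fin k → ℝ) → EuclideanSpace ℝ (Fin d)) (x : EuclideanSpace ℝ (Fin d)) : ℝ :=
  min (‖g (h x) - x‖ ^ 2) (‖g (h x) + x‖ ^ 2)

end SpectralAutoencoder

end

/-! Against any feasible competitor, Frank–Wolfe closes the gap at rate (smoothness) × (diameter)² /
t. The competitor is the matrix `B * A` given by decodability: rank at most k and operator norm at
most τ give trace norm at most τk, and its objective is at most ε². Hence f ≤ ε² + O(k²τ²/k') after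
k' steps. The first step has size 1 and erases the start, and every step adds one rank one matrix,
so the rank is at most k'.

The smoothness estimate must not depend on the dimension. The second differences of f in direction S
are at most a constant, depending only on P, times 𝔼‖S x^{⊗2}‖² in the Hilbert–Schmidt norm. Since
x^{⊗2} is a unit vector, this energy is at most the squared operator norm of S, and so at most
(2τk)² for a difference of two feasible points. For a convex function such a bound yields
differentiability and a quadratic upper bound (`exists_hasFDerivAt_of_convexOn`).

The second difference bound is `opSchattenNorm_sq_add_sq_sub_le`. It rests on the expansion of ∑
σ_i^p in `exists_schattenPow_tangent`: in the singular bases of A and B, the Taylor remainder is a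
nonnegative combination of scalar Taylor remainders of |x|^p between α_i and ±β_j. Their
nonnegativity gives convexity, hence the triangle inequality; their quadratic bounds give
smoothness.

For the decoder, a top right-singular vector v of T satisfies T*T v = ‖T v‖² v. If T is within e of
x xᵀ, this forces the part of v orthogonal to x to have size O(e) (`min_norm_sub_sq_le`). -/

namespace SpectralAutoencoder

/-! ### Singular values and the first order expansion of ∑ σ_i^p -/

section LinearMaps

open Module LinearMap InnerProductSpace

local notation "⟪" x ", " y "⟫" => inner ℝ x y

variable {E : Type*} [NormedAddCommGroup E] [InnerProductSpace ℝ E] [FiniteDimensional ℝ E]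

/-- Singular value decomposition of an endomorphism. -/
theorem exists_svd (T : E →ₗ[ℝ] E) :
    ∃ u v : OrthonormalBasis (Fin (finrank ℝ E)) ℝ E, ∀ i,
      T (v i) = T.singularValues i • u i ∧ adjoint T (u i) = T.singularValues i • v i := by
  set v := T.isSymmetric_adjoint_comp_self.eigenvectorBasis rfl with hv
  have hev (i) : adjoint T (T (v i)) = (T.singularValues i ^ 2) • v i := by
    have := T.isSymmetric_adjoint_comp_self.apply_eigenvectorBasis rfl i
    rw [T.sq_singularValues_fin rfl i]
    exact this
  have hin (i j) : ⟪T (v i), T (v j)⟫ = if i = j then T.singularValues i ^ 2 else 0 := by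
    rw [← adjoint_inner_left, hev, inner_smul_left, v.inner_eq_ite]
    split_ifs <;> simp
  let s : Set (Fin (finrank ℝ E)) := {i | T.singularValues i ≠ 0}
  let w : Fin (finrank ℝ E) → E := fun i => (T.singularValues i)⁻¹ • T (v i)
  have hw : Orthonormal ℝ (s.domRestrict w) := by
    rw [orthonormal_iff_ite]
    rintro ⟨i, hi⟩ ⟨j, hj⟩
    have hi' : T.singularValues i ≠ 0 := hi
    simp only [Set.domRestrict_apply, w, inner_smul_left, inner_smul_right, hin, Subtype.mk.injEq]
    split_ifs with h
    · subst h
      simp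
      field_simp
    · simp
  obtain ⟨u, hu⟩ := hw.exists_orthonormalBasis_extension_of_card_eq (by simp)
  have hT (i) : T (v i) = T.singularValues i • u i := by
    by_cases h : T.singularValues i = 0
    · have := hin i i
      simp only [h, if_true] at this
      rw [h, zero_smul, ← inner_self_eq_zero (𝕜 := ℝ), this]
      norm_num
    · rw [hu i h, smul_smul, mul_inv_cancel₀ h, one_smul]
  refine ⟨u, v, fun i => ⟨hT i, ext_inner_right_basis v.toBasis fun j => ?_⟩⟩
  rw [v.coe_toBasis, adjoint_inner_left, hT, inner_smul_left, inner_smul_right,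
    u.inner_eq_ite, v.inner_eq_ite]
  split_ifs with h
  · simp [h]
  · simp

/-- The sum of the `p`-th powers of the singular values. -/
noncomputable def schattenPow (p : ℝ) (T : E →ₗ[ℝ] E) : ℝ :=
  T.singularValues.sum fun _ s => s ^ p

theorem schattenPow_eq_sum {p : ℝ} (hp : p ≠ 0) (T : E →ₗ[ℝ] E) :
    schattenPow p T = ∑ i : Fin (finrank ℝ E), T.singularValues i ^ p := by
  rw [schattenPow, Finsupp.sum_of_support_subset (s := Finset.range (finrank ℝ E)),
    Finset.sum_range]
  · rw [support_singularValues]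
    exact Finset.range_mono (Submodule.finrank_le _)
  · simp [hp]

theorem schattenPow_nonneg (p : ℝ) (T : E →ₗ[ℝ] E) : 0 ≤ schattenPow p T :=
  Finset.sum_nonneg fun i _ => Real.rpow_nonneg (T.singularValues_nonneg i) p

theorem singularValues_rpow_le_schattenPow {p : ℝ} (hp : p ≠ 0) (T : E →ₗ[ℝ] E)
    (i : Fin (finrank ℝ E)) : T.singularValues i ^ p ≤ schattenPow p T := by
  rw [schattenPow_eq_sum hp]
  exact Finset.single_le_sum (f := fun i : Fin (finrank ℝ E) => T.singularValues i ^ p)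
    (fun i _ => Real.rpow_nonneg (T.singularValues_nonneg i) p) (Finset.mem_univ i)

/-- The square of the Hilbert-Schmidt norm. -/
noncomputable def hsNormSq (T : E →ₗ[ℝ] E) : ℝ :=
  ∑ i, ‖T (stdOrthonormalBasis ℝ E i)‖ ^ 2

theorem hsNormSq_nonneg (T : E →ₗ[ℝ] E) : 0 ≤ hsNormSq T :=
  Finset.sum_nonneg fun _ _ => sq_nonneg _

/-- By Parseval both sides sum the squared entries ⟪T b_i, c_j⟫. Used twice, this makes the
Hilbert–Schmidt norm independent of the basis. -/
theorem sum_norm_sq_eq_sum_adjoint {ι κ : Type*} [Fintype ι] [Fintype κ]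
    (b : OrthonormalBasis ι ℝ E) (c : OrthonormalBasis κ ℝ E) (T : E →ₗ[ℝ] E) :
    ∑ i, ‖T (b i)‖ ^ 2 = ∑ j, ‖adjoint T (c j)‖ ^ 2 := by
  simp_rw [← c.sum_sq_inner_right (T (b _)), ← b.sum_sq_inner_left (adjoint T (c _)),
    adjoint_inner_left]
  exact Finset.sum_comm

theorem sum_norm_sq_eq_hsNormSq {ι : Type*} [Fintype ι] (b : OrthonormalBasis ι ℝ E)
    (T : E →ₗ[ℝ] E) : ∑ i, ‖T (b i)‖ ^ 2 = hsNormSq T := by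
  rw [sum_norm_sq_eq_sum_adjoint b b, ← sum_norm_sq_eq_sum_adjoint (stdOrthonormalBasis ℝ E) b, hsNormSq]

theorem hsNormSq_eq_sum_sq (T : E →ₗ[ℝ] E) :
    hsNormSq T = ∑ i : Fin (finrank ℝ E), T.singularValues i ^ 2 := by
  obtain ⟨u, v, h⟩ := exists_svd T
  rw [← sum_norm_sq_eq_hsNormSq v]
  simp [(h _).1, norm_smul]

theorem norm_apply_sq_eq_sum {T : E →ₗ[ℝ] E} {u v : OrthonormalBasis (Fin (finrank ℝ E)) ℝ E}
    (h : ∀ i, adjoint T (u i) = T.singularValues i • v i) (x : E) :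
    ‖T x‖ ^ 2 = ∑ i : Fin (finrank ℝ E), T.singularValues i ^ 2 * ⟪v i, x⟫ ^ 2 := by
  rw [← u.sum_sq_inner_right]
  refine Finset.sum_congr rfl fun i _ => ?_
  rw [← adjoint_inner_left, h, real_inner_smul_left, mul_pow]

theorem norm_apply_le_of_singularValues_le {T : E →ₗ[ℝ] E} {c : ℝ}
    (hc : ∀ i : Fin (finrank ℝ E), T.singularValues i ≤ c) (hc0 : 0 ≤ c) (x : E) :
    ‖T x‖ ≤ c * ‖x‖ := by
  obtain ⟨u, v, h⟩ := exists_svd T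
  refine le_of_sq_le_sq ?_ (by positivity)
  rw [norm_apply_sq_eq_sum fun i => (h i).2, mul_pow, ← v.sum_sq_inner_right, Finset.mul_sum]
  gcongr with i
  · exact T.singularValues_nonneg i
  · exact hc i

/-- Bernoulli's inequality: the graph of `x ^ q` lies above its tangents. -/
theorem rpow_tangent_le {q a b : ℝ} (hq : 1 ≤ q) (ha : 0 ≤ a) (hb : 0 ≤ b) :
    a ^ q + q * a ^ (q - 1) * (b - a) ≤ b ^ q := by
  rcases ha.eq_or_lt with rfl | ha
  · rcases hq.eq_or_lt with rfl | hq
    · simp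
    · rw [Real.zero_rpow (by linarith), Real.zero_rpow (by linarith)]
      simpa using Real.rpow_nonneg hb q
  · have h := one_add_mul_self_le_rpow_one_add (s := b / a - 1) (p := q)
      (by have := div_nonneg hb ha.le; linarith) hq
    rw [add_sub_cancel, Real.div_rpow hb ha.le, le_div_iff₀ (Real.rpow_pos_of_pos ha q)] at h
    refine le_trans (le_of_eq ?_) h
    rw [Real.rpow_sub_one ha.ne']
    field_simp

/-- The remainder of the first order Taylor expansion of `x ^ p`. -/
theorem rpow_sub_tangent_le {p a b M : ℝ} (hp : 2 ≤ p) (ha : 0 ≤ a) (hb : 0 ≤ b) (haM : a ≤ M)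
    (hbM : b ≤ M) :
    b ^ p - a ^ p - p * a ^ (p - 1) * (b - a) ≤ p ^ 2 * M ^ (p - 2) * (b - a) ^ 2 := by
  have key {a b : ℝ} (ha : 0 ≤ a) (hab : a ≤ b) (hbM : b ≤ M) :
      (b ^ (p - 1) - a ^ (p - 1)) ≤ p * M ^ (p - 2) * (b - a) := by
    have h := rpow_tangent_le (q := p - 1) (by linarith) (ha.trans hab) ha
    have h2 : b ^ (p - 2) ≤ M ^ (p - 2) :=
      Real.rpow_le_rpow (ha.trans hab) hbM (by linarith)
    rw [show p - 1 - 1 = p - 2 by ring] at h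
    calc b ^ (p - 1) - a ^ (p - 1) ≤ (p - 1) * b ^ (p - 2) * (b - a) := by linarith
      _ ≤ p * M ^ (p - 2) * (b - a) := by
        have := Real.rpow_nonneg (ha.trans hab) (p - 2)
        gcongr
        linarith
  -- The tangent at `b`, evaluated at `a`, bounds the remainder by p (b^(p-1) - a^(p-1)) (b - a).
  have h1 := rpow_tangent_le (q := p) (by linarith) hb ha
  have h2 : (b ^ (p - 1) - a ^ (p - 1)) * (b - a) ≤ p * M ^ (p - 2) * (b - a) ^ 2 := by
    rcases le_total a b with hab | hab
    · have := mul_le_mul_of_nonneg_right (key ha hab hbM) (sub_nonneg.2 hab)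
      linarith
    · have := mul_le_mul_of_nonneg_right (key hb hab haM) (sub_nonneg.2 hab)
      linarith
  have h3 := mul_le_mul_of_nonneg_left h2 (show 0 ≤ p by linarith)
  linarith

/-- The remainder of the Taylor expansion of `|x| ^ p` between points of opposite sign. -/
theorem rpow_sub_tangent_neg_le {p a b M : ℝ} (hp : 2 ≤ p) (ha : 0 ≤ a) (hb : 0 ≤ b)
    (haM : a ≤ M) (hbM : b ≤ M) :
    b ^ p - a ^ p + p * a ^ (p - 1) * (b + a) ≤ p ^ 2 * M ^ (p - 2) * (b + a) ^ 2 := by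
  have e1 {c : ℝ} (hc : 0 ≤ c) : c ^ p = c ^ (p - 2) * c ^ 2 := by
    rw [← Real.rpow_natCast c 2, ← Real.rpow_add_of_nonneg hc (by linarith) (by norm_num)]
    norm_num
  have e2 : a ^ (p - 1) = a ^ (p - 2) * a := by
    conv_rhs => rw [← Real.rpow_one a, ← Real.rpow_mul ha, one_mul]
    rw [← Real.rpow_add_of_nonneg ha (by linarith) (by norm_num)]
    ring_nf
  have ha2 : a ^ (p - 2) ≤ M ^ (p - 2) := Real.rpow_le_rpow ha haM (by linarith)
  have hb2 : b ^ (p - 2) ≤ M ^ (p - 2) := Real.rpow_le_rpow hb hbM (by linarith)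
  have h0 := Real.rpow_nonneg ha p
  have hM : 0 ≤ M ^ (p - 2) := Real.rpow_nonneg (ha.trans haM) _
  calc b ^ p - a ^ p + p * a ^ (p - 1) * (b + a)
      ≤ b ^ (p - 2) * b ^ 2 + p * (a ^ (p - 2) * a) * (b + a) := by
        rw [← e1 hb, ← e2]; linarith
    _ ≤ M ^ (p - 2) * (b + a) ^ 2 + p * (M ^ (p - 2) * (b + a)) * (b + a) := by
        gcongr <;> linarith
    _ = (1 + p) * M ^ (p - 2) * (b + a) ^ 2 := by ring
    _ ≤ p ^ 2 * M ^ (p - 2) * (b + a) ^ 2 := by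
        gcongr
        nlinarith

/-- First order expansion of `T ↦ ∑ σ_i(T) ^ p`: an affine minorant, and, if `p ≥ 2`, a
quadratic bound for the difference. -/
theorem exists_schattenPow_tangent {p : ℝ} (hp : 1 ≤ p) (A : E →ₗ[ℝ] E) :
    ∃ L : (E →ₗ[ℝ] E) →ₗ[ℝ] ℝ,
      (∀ B, schattenPow p A + L (B - A) ≤ schattenPow p B) ∧
      (2 ≤ p → ∀ (B : E →ₗ[ℝ] E) (M : ℝ),
        (∀ i : Fin (finrank ℝ E), A.singularValues i ≤ M) →
        (∀ i : Fin (finrank ℝ E), B.singularValues i ≤ M) →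
        schattenPow p B ≤
          schattenPow p A + L (B - A) + p ^ 2 * M ^ (p - 2) * hsNormSq (B - A)) := by
  obtain ⟨u, v, hA⟩ := exists_svd A
  set α : Fin (finrank ℝ E) → ℝ := fun i => A.singularValues i with hα
  have hα0 (i) : 0 ≤ α i := A.singularValues_nonneg i
  let L : (E →ₗ[ℝ] E) →ₗ[ℝ] ℝ :=
    { toFun := fun K => ∑ i, p * α i ^ (p - 1) * ⟪u i, K (v i)⟫
      map_add' := fun K K' => by
        simp [inner_add_right, mul_add, Finset.sum_add_distrib]
      map_smul' := fun c K => by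
        simp only [LinearMap.smul_apply, inner_smul_right, Finset.mul_sum, RingHom.id_apply,
          smul_eq_mul]
        exact Finset.sum_congr rfl fun i _ => by ring }
  -- This is the spectral decomposition of the self-adjoint dilation, whose eigenvalues are ±σ. The
  -- overlaps of the left and right singular bases are `a` and `b`, so (a ± b)/2 are the overlaps of
  -- eigenvectors for eigenvalues of equal or opposite sign. The entries of `B - A` in the mixed
  -- bases are `m` and `n`.
  have key (B : E →ₗ[ℝ] E) : ∃ a b m n : Fin (finrank ℝ E) → Fin (finrank ℝ E) → ℝ,
      schattenPow p B - schattenPow p A - L (B - A) = ∑ i, ∑ j,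
        ((a i j + b i j) ^ 2 / 4 * (B.singularValues j ^ p - α i ^ p
            - p * α i ^ (p - 1) * (B.singularValues j - α i))
          + (a i j - b i j) ^ 2 / 4 * (B.singularValues j ^ p - α i ^ p
            + p * α i ^ (p - 1) * (B.singularValues j + α i))) ∧
      (∀ i j, (a i j + b i j) ^ 2 * (B.singularValues j - α i) ^ 2
        + (a i j - b i j) ^ 2 * (B.singularValues j + α i) ^ 2 = 2 * (m i j ^ 2 + n i j ^ 2)) ∧
      ∑ i, ∑ j, m i j ^ 2 = hsNormSq (B - A) ∧ ∑ i, ∑ j, n i j ^ 2 = hsNormSq (B - A) := by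
    obtain ⟨w, z, hB⟩ := exists_svd B
    set β : Fin (finrank ℝ E) → ℝ := fun i => B.singularValues i with hβ
    have hBv (i j) : ⟪w j, B (v i)⟫ = β j * ⟪v i, z j⟫ := by
      rw [← adjoint_inner_left, (hB j).2, real_inner_smul_left, real_inner_comm]
    have hBz (i j) : ⟪u i, B (z j)⟫ = β j * ⟪u i, w j⟫ := by
      rw [(hB j).1, real_inner_smul_right]
    have hAv (i j) : ⟪w j, A (v i)⟫ = α i * ⟪u i, w j⟫ := by
      rw [(hA i).1, real_inner_smul_right, real_inner_comm]
    have hAz (i j) : ⟪u i, A (z j)⟫ = α i * ⟪v i, z j⟫ := by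
      rw [← adjoint_inner_left, (hA i).2, real_inner_smul_left]
    have hu (i) : ∑ j, ⟪u i, w j⟫ ^ 2 = 1 := by
      rw [w.sum_sq_inner_left]; simp
    have hv (i) : ∑ j, ⟪v i, z j⟫ ^ 2 = 1 := by
      rw [z.sum_sq_inner_left]; simp
    have hw (j) : ∑ i, ⟪u i, w j⟫ ^ 2 = 1 := by
      rw [u.sum_sq_inner_right]; simp
    have hz (j) : ∑ i, ⟪v i, z j⟫ ^ 2 = 1 := by
      rw [v.sum_sq_inner_right]; simp
    refine ⟨fun i j => ⟪u i, w j⟫, fun i j => ⟪v i, z j⟫, fun i j => ⟪w j, (B - A) (v i)⟫,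
      fun i j => ⟪u i, (B - A) (z j)⟫, ?_, fun i j => ?_, ?_, ?_⟩
    · have e1 : schattenPow p B = ∑ i, ∑ j, (⟪u i, w j⟫ ^ 2 + ⟪v i, z j⟫ ^ 2) / 2 * β j ^ p := by
        rw [Finset.sum_comm, schattenPow_eq_sum (by linarith)]
        refine Finset.sum_congr rfl fun j _ => ?_
        rw [← Finset.sum_mul, ← Finset.sum_div, Finset.sum_add_distrib, hw, hz]
        norm_num [hβ]
      have e2 (c : Fin (finrank ℝ E) → ℝ) :
          ∑ i, c i = ∑ i, ∑ j, (⟪u i, w j⟫ ^ 2 + ⟪v i, z j⟫ ^ 2) / 2 * c i := by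
        refine Finset.sum_congr rfl fun i _ => ?_
        rw [← Finset.sum_mul, ← Finset.sum_div, Finset.sum_add_distrib, hu, hv]
        norm_num
      have e3 : L (B - A) = ∑ i, ∑ j, p * α i ^ (p - 1) * (β j * ⟪u i, w j⟫ * ⟪v i, z j⟫)
          - ∑ i, p * α i ^ (p - 1) * α i := by
        change ∑ i, p * α i ^ (p - 1) * ⟪u i, (B - A) (v i)⟫ = _
        rw [← Finset.sum_sub_distrib]
        refine Finset.sum_congr rfl fun i _ => ?_
        rw [LinearMap.sub_apply, inner_sub_right, (hA i).1, real_inner_smul_right,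
          real_inner_self_eq_norm_sq, u.norm_eq_one, ← w.sum_inner_mul_inner, mul_sub,
          Finset.mul_sum]
        simp only [hBv, hα]
        congr 1
        · exact Finset.sum_congr rfl fun j _ => by ring
        · ring
      rw [e1, schattenPow_eq_sum (by linarith), e3, e2 (fun i => A.singularValues i ^ p),
        e2 (fun i => p * α i ^ (p - 1) * α i)]
      simp only [← Finset.sum_sub_distrib]
      refine Finset.sum_congr rfl fun i _ => Finset.sum_congr rfl fun j _ => ?_
      simp only [hα, hβ]
      ring
    · simp only [LinearMap.sub_apply, inner_sub_right, hBv, hBz, hAv, hAz]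
      ring
    · rw [← sum_norm_sq_eq_hsNormSq v]
      exact Finset.sum_congr rfl fun i _ => w.sum_sq_inner_right _
    · rw [Finset.sum_comm, ← sum_norm_sq_eq_hsNormSq z]
      exact Finset.sum_congr rfl fun i _ => u.sum_sq_inner_right _
  refine ⟨L, fun B => ?_, fun hp2 B M hAM hBM => ?_⟩
  · obtain ⟨a, b, m, n, h1, -⟩ := key B
    have : 0 ≤ schattenPow p B - schattenPow p A - L (B - A) := by
      rw [h1]
      refine Finset.sum_nonneg fun i _ => Finset.sum_nonneg fun j _ => ?_
      have hb := B.singularValues_nonneg j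
      have t1 := rpow_tangent_le hp (hα0 i) hb
      have t2 : 0 ≤ B.singularValues j ^ p - α i ^ p
          + p * α i ^ (p - 1) * (B.singularValues j + α i) := by
        have e : α i ^ p ≤ p * α i ^ (p - 1) * α i := by
          rcases (hα0 i).eq_or_lt with h | h
          · rw [← h, Real.zero_rpow (by linarith)]; simp
          · rw [Real.rpow_sub_one h.ne', mul_assoc, div_mul_cancel₀ _ h.ne']
            nlinarith [Real.rpow_nonneg (hα0 i) p]
        have := Real.rpow_nonneg hb p
        have : 0 ≤ p * α i ^ (p - 1) * B.singularValues j :=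
          mul_nonneg (mul_nonneg (by linarith) (Real.rpow_nonneg (hα0 i) _)) hb
        linarith
      refine add_nonneg (mul_nonneg (by positivity) (by linarith)) (mul_nonneg (by positivity) t2)
    linarith
  · obtain ⟨a, b, m, n, h1, h2, h3, h4⟩ := key B
    suffices schattenPow p B - schattenPow p A - L (B - A)
        ≤ p ^ 2 * M ^ (p - 2) * hsNormSq (B - A) by linarith
    have h5 : p ^ 2 * M ^ (p - 2) * hsNormSq (B - A) =
        ∑ i, ∑ j, p ^ 2 * M ^ (p - 2) * ((m i j ^ 2 + n i j ^ 2) / 2) := by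
      simp only [← Finset.mul_sum, ← Finset.sum_div, Finset.sum_add_distrib, h3, h4]
      ring
    rw [h1, h5]
    refine Finset.sum_le_sum fun i _ => Finset.sum_le_sum fun j _ => ?_
    have hb := B.singularValues_nonneg j
    have t1 := rpow_sub_tangent_le hp2 (hα0 i) hb (hAM i) (hBM j)
    have t2 := rpow_sub_tangent_neg_le hp2 (hα0 i) hb (hAM i) (hBM j)
    have t3 := mul_le_mul_of_nonneg_left t1 (show 0 ≤ (a i j + b i j) ^ 2 / 4 by positivity)
    have t4 := mul_le_mul_of_nonneg_left t2 (show 0 ≤ (a i j - b i j) ^ 2 / 4 by positivity)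
    refine (add_le_add t3 t4).trans (le_of_eq ?_)
    linear_combination p ^ 2 * M ^ (p - 2) / 4 * h2 i j

end LinearMaps

/-! ### Schatten norms: triangle inequality and uniform smoothness -/

section SchattenNorm

open Module LinearMap InnerProductSpace

local notation "⟪" x ", " y "⟫" => inner ℝ x y

variable {E : Type*} [NormedAddCommGroup E] [InnerProductSpace ℝ E] [FiniteDimensional ℝ E]

/-- The singular values can be computed from any orthonormal eigenbasis of `T* T`. -/
theorem schattenPow_eq_of_eigenbasis {p : ℝ} (hp : p ≠ 0) (T : E →ₗ[ℝ] E)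
    (z : OrthonormalBasis (Fin (finrank ℝ E)) ℝ E) (β : Fin (finrank ℝ E) → ℝ)
    (hβ : ∀ j, 0 ≤ β j) (h : ∀ j, adjoint T (T (z j)) = (β j ^ 2) • z j) :
    schattenPow p T = ∑ j, β j ^ p := by
  obtain ⟨u, v, hT⟩ := exists_svd T
  have hv (i) : adjoint T (T (v i)) = (T.singularValues i ^ 2) • v i := by
    rw [(hT i).1, map_smul, (hT i).2, smul_smul, sq]
  -- Eigenvectors of T*T for distinct eigenvalues are orthogonal, so the doubly stochastic weights
  -- ⟪v i, z j⟫² couple only equal singular values.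
  have key (i j) : ⟪v i, z j⟫ ^ 2 * T.singularValues i ^ p = ⟪v i, z j⟫ ^ 2 * β j ^ p := by
    have e : ⟪adjoint T (T (v i)), z j⟫ = ⟪v i, adjoint T (T (z j))⟫ := by
      rw [adjoint_inner_left, adjoint_inner_right]
    rw [hv, h, real_inner_smul_left, real_inner_smul_right] at e
    have e' : (T.singularValues i ^ 2 - β j ^ 2) * ⟪v i, z j⟫ = 0 := by linarith
    rcases mul_eq_zero.1 e' with e' | e'
    · rw [(sq_eq_sq₀ (T.singularValues_nonneg i) (hβ j)).1 (by linarith)]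
    · simp [e']
  rw [schattenPow_eq_sum hp]
  calc ∑ i : Fin (finrank ℝ E), T.singularValues i ^ p
      = ∑ i, ∑ j, ⟪v i, z j⟫ ^ 2 * T.singularValues i ^ p := by
        refine Finset.sum_congr rfl fun i _ => ?_
        rw [← Finset.sum_mul, z.sum_sq_inner_left]
        simp
    _ = ∑ j, ∑ i, ⟪v i, z j⟫ ^ 2 * β j ^ p := by
        rw [Finset.sum_comm]
        simp only [key]
    _ = ∑ j, β j ^ p := by
        refine Finset.sum_congr rfl fun j _ => ?_
        rw [← Finset.sum_mul, v.sum_sq_inner_right]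
        simp

theorem schattenPow_smul {p : ℝ} (hp : p ≠ 0) (c : ℝ) (T : E →ₗ[ℝ] E) :
    schattenPow p (c • T) = |c| ^ p * schattenPow p T := by
  obtain ⟨u, v, hT⟩ := exists_svd T
  rw [schattenPow_eq_of_eigenbasis hp (c • T) v (fun i => |c| * T.singularValues i)
    (fun i => mul_nonneg (abs_nonneg c) (T.singularValues_nonneg i)), schattenPow_eq_sum hp,
    Finset.mul_sum]
  · exact Finset.sum_congr rfl fun i _ =>
      Real.mul_rpow (abs_nonneg c) (T.singularValues_nonneg i)
  · intro i
    rw [map_smulₛₗ]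
    simp only [LinearMap.smul_apply, (hT i).1, map_smul, (hT i).2, smul_smul, mul_pow, sq_abs]
    congr 1
    simp
    ring

/-- The Schatten `p`-norm of an endomorphism. -/
noncomputable def opSchattenNorm (p : ℝ) (T : E →ₗ[ℝ] E) : ℝ := schattenPow p T ^ (1 / p)

theorem opSchattenNorm_nonneg (p : ℝ) (T : E →ₗ[ℝ] E) : 0 ≤ opSchattenNorm p T :=
  Real.rpow_nonneg (schattenPow_nonneg p T) _

theorem opSchattenNorm_rpow {p : ℝ} (hp : p ≠ 0) (T : E →ₗ[ℝ] E) :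
    opSchattenNorm p T ^ p = schattenPow p T := by
  rw [opSchattenNorm, one_div, Real.rpow_inv_rpow (schattenPow_nonneg p T) hp]

theorem opSchattenNorm_le_iff {p : ℝ} (hp : 0 < p) (T : E →ₗ[ℝ] E) {c : ℝ} (hc : 0 ≤ c) :
    opSchattenNorm p T ≤ c ↔ schattenPow p T ≤ c ^ p := by
  rw [← opSchattenNorm_rpow hp.ne', Real.rpow_le_rpow_iff (opSchattenNorm_nonneg p T) hc hp]

theorem opSchattenNorm_smul {p : ℝ} (hp : p ≠ 0) (c : ℝ) (T : E →ₗ[ℝ] E) :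
    opSchattenNorm p (c • T) = |c| * opSchattenNorm p T := by
  rw [opSchattenNorm, schattenPow_smul hp, Real.mul_rpow (by positivity) (schattenPow_nonneg p T),
    one_div, Real.rpow_rpow_inv (abs_nonneg c) hp, opSchattenNorm, one_div]

theorem singularValues_le_opSchattenNorm {p : ℝ} (hp : 0 < p) (T : E →ₗ[ℝ] E)
    (i : Fin (finrank ℝ E)) : T.singularValues i ≤ opSchattenNorm p T := by
  rw [← Real.rpow_le_rpow_iff (T.singularValues_nonneg i) (opSchattenNorm_nonneg p T) hp,
    opSchattenNorm_rpow hp.ne']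
  exact singularValues_rpow_le_schattenPow hp.ne' T i

theorem norm_apply_le_opSchattenNorm {p : ℝ} (hp : 0 < p) (T : E →ₗ[ℝ] E) (x : E) :
    ‖T x‖ ≤ opSchattenNorm p T * ‖x‖ :=
  norm_apply_le_of_singularValues_le (singularValues_le_opSchattenNorm hp T)
    (opSchattenNorm_nonneg p T) x

/-- The affine minorants make the unit ball {∑ σ_i^p ≤ 1} convex, and the norm is its gauge. -/
theorem opSchattenNorm_add_le {p : ℝ} (hp : 1 ≤ p) (X Y : E →ₗ[ℝ] E) :
    opSchattenNorm p (X + Y) ≤ opSchattenNorm p X + opSchattenNorm p Y := by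
  have hp0 : 0 < p := by linarith
  refine le_of_forall_pos_le_add fun η hη => ?_
  have hx0 := opSchattenNorm_nonneg p X
  have hy0 := opSchattenNorm_nonneg p Y
  -- The slack keeps both normalizing factors positive, also when `X` or `Y` is zero.
  set x := opSchattenNorm p X + η / 2 with hx
  set y := opSchattenNorm p Y + η / 2 with hy
  have hxp : 0 < x := by positivity
  have hyp : 0 < y := by positivity
  have key {Z : E →ₗ[ℝ] E} {z : ℝ} (hz : 0 < z) (h : opSchattenNorm p Z ≤ z) :
      schattenPow p (z⁻¹ • Z) ≤ 1 := by
    have := (opSchattenNorm_le_iff hp0 (z⁻¹ • Z) zero_le_one).1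
    rw [Real.one_rpow] at this
    apply this
    rw [opSchattenNorm_smul hp0.ne', abs_of_pos (inv_pos.2 hz), inv_mul_le_iff₀ hz]
    linarith
  obtain ⟨L, hL, -⟩ := exists_schattenPow_tangent hp ((x + y)⁻¹ • (X + Y))
  have h1 := (hL (x⁻¹ • X)).trans (key hxp (by linarith))
  have h2 := (hL (y⁻¹ • Y)).trans (key hyp (by linarith))
  -- The tangent is taken at the weighted mean of x⁻¹X and y⁻¹Y, so the linear terms cancel.
  have h3 : x * L (x⁻¹ • X - (x + y)⁻¹ • (X + Y)) + y * L (y⁻¹ • Y - (x + y)⁻¹ • (X + Y)) = 0 := by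
    simp only [map_sub, map_smul, map_add, smul_eq_mul]
    field_simp
    ring
  have h4 : schattenPow p ((x + y)⁻¹ • (X + Y)) ≤ 1 := by
    have := mul_le_mul_of_nonneg_left h1 hxp.le
    have := mul_le_mul_of_nonneg_left h2 hyp.le
    have h5 : (x + y) * schattenPow p ((x + y)⁻¹ • (X + Y)) ≤ (x + y) * 1 := by linarith
    exact le_of_mul_le_mul_left h5 (by positivity)
  have h6 : opSchattenNorm p ((x + y)⁻¹ • (X + Y)) ≤ 1 := by
    rwa [opSchattenNorm_le_iff hp0 _ zero_le_one, Real.one_rpow]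
  rw [opSchattenNorm_smul hp0.ne', abs_of_pos (by positivity),
    inv_mul_le_iff₀ (by positivity)] at h6
  linarith

theorem opSchattenNorm_neg {p : ℝ} (hp : p ≠ 0) (X : E →ₗ[ℝ] E) :
    opSchattenNorm p (-X) = opSchattenNorm p X := by
  have := opSchattenNorm_smul hp (-1) X
  simpa using this

theorem abs_opSchattenNorm_sub_le {p : ℝ} (hp : 1 ≤ p) (X Y : E →ₗ[ℝ] E) :
    |opSchattenNorm p X - opSchattenNorm p Y| ≤ opSchattenNorm p (X - Y) := by
  have h1 := opSchattenNorm_add_le hp (X - Y) Y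
  have h2 := opSchattenNorm_add_le hp (Y - X) X
  rw [← neg_sub X Y, opSchattenNorm_neg (by linarith)] at h2
  rw [neg_sub] at h2
  simp only [sub_add_cancel] at h1 h2
  rw [abs_le]
  constructor <;> linarith

theorem opSchattenNorm_sq_convex {p : ℝ} (hp : 1 ≤ p) (X Y : E →ₗ[ℝ] E) {a b : ℝ} (ha : 0 ≤ a)
    (hb : 0 ≤ b) (hab : a + b = 1) :
    opSchattenNorm p (a • X + b • Y) ^ 2 ≤
      a * opSchattenNorm p X ^ 2 + b * opSchattenNorm p Y ^ 2 := by
  have h := opSchattenNorm_add_le hp (a • X) (b • Y)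
  rw [opSchattenNorm_smul (by linarith), opSchattenNorm_smul (by linarith), abs_of_nonneg ha,
    abs_of_nonneg hb] at h
  refine (pow_le_pow_left₀ (opSchattenNorm_nonneg _ _) h 2).trans ?_
  obtain rfl : b = 1 - a := by linarith
  nlinarith [mul_nonneg (mul_nonneg ha hb) (sq_nonneg (opSchattenNorm p X - opSchattenNorm p Y))]

/-- Each σ^p = σ^(p-2) σ² is at most h^(p-2) σ², since no singular value exceeds the Hilbert–Schmidt
norm h. -/
theorem opSchattenNorm_le_sqrt_hsNormSq {p : ℝ} (hp : 2 ≤ p) (T : E →ₗ[ℝ] E) :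
    opSchattenNorm p T ≤ √(hsNormSq T) := by
  have hM := Real.sqrt_nonneg (hsNormSq T)
  have e1 {c : ℝ} (hc : 0 ≤ c) : c ^ p = c ^ (p - 2) * c ^ 2 := by
    rw [← Real.rpow_natCast c 2, ← Real.rpow_add_of_nonneg hc (by linarith) (by norm_num)]
    norm_num
  rw [opSchattenNorm_le_iff (by linarith) T hM, e1 hM, Real.sq_sqrt (hsNormSq_nonneg T),
    schattenPow_eq_sum (by linarith), hsNormSq_eq_sum_sq T, Finset.mul_sum]
  refine Finset.sum_le_sum fun i _ => ?_
  rw [e1 (T.singularValues_nonneg i)]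
  refine mul_le_mul_of_nonneg_right (Real.rpow_le_rpow (T.singularValues_nonneg i) ?_
    (by linarith)) (sq_nonneg _)
  refine Real.le_sqrt_of_sq_le ?_
  exact Finset.single_le_sum (f := fun i : Fin (finrank ℝ E) => T.singularValues i ^ 2)
    (fun i _ => sq_nonneg _) (Finset.mem_univ i)

/-- Uniform smoothness of the Schatten `p`-norms for `p ≥ 2`, with the error measured in the
Hilbert-Schmidt norm. -/
theorem opSchattenNorm_sq_add_sq_sub_le {p P : ℝ} (hp : 2 ≤ p) (hpP : p ≤ P) (X Y : E →ₗ[ℝ] E) :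
    opSchattenNorm p (X + Y) ^ 2 + opSchattenNorm p (X - Y) ^ 2 ≤
      2 * opSchattenNorm p X ^ 2 + (8 + P * 2 ^ P) * hsNormSq Y := by
  have hp0 : 0 < p := by linarith
  have hK : 0 ≤ P * 2 ^ P := mul_nonneg (by linarith) (by positivity)
  set h := √(hsNormSq Y) with hh
  have hh2 : hsNormSq Y = h ^ 2 := (Real.sq_sqrt (hsNormSq_nonneg Y)).symm
  have hYh : opSchattenNorm p Y ≤ h := opSchattenNorm_le_sqrt_hsNormSq hp Y
  have hh0 : 0 ≤ h := Real.sqrt_nonneg _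
  set a := opSchattenNorm p (X + Y) with ha
  set b := opSchattenNorm p (X - Y) with hb
  set x := opSchattenNorm p X with hx
  have ha0 : 0 ≤ a := opSchattenNorm_nonneg _ _
  have hb0 : 0 ≤ b := opSchattenNorm_nonneg _ _
  have hx0 : 0 ≤ x := opSchattenNorm_nonneg _ _
  have hax : a ≤ x + h := (opSchattenNorm_add_le (by linarith) X Y).trans (by linarith)
  have hbx : b ≤ x + h := by
    have := opSchattenNorm_add_le (p := p) (by linarith) X (-Y)
    rw [opSchattenNorm_neg hp0.ne', ← sub_eq_add_neg] at this
    linarith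
  rw [hh2]
  -- If x ≤ h, then a and b are at most 2h, whence the constant 8. Otherwise x + h ≤ 2x, and adding
  -- the expansions at ±Y cancels the linear terms.
  rcases le_or_gt x h with hxh | hxh
  · have h1 : a ^ 2 ≤ (2 * h) ^ 2 := pow_le_pow_left₀ ha0 (by linarith) 2
    have h2 : b ^ 2 ≤ (2 * h) ^ 2 := pow_le_pow_left₀ hb0 (by linarith) 2
    nlinarith [mul_nonneg hK (sq_nonneg h), sq_nonneg x]
  · have hxp : 0 < x := hh0.trans_lt hxh
    obtain ⟨L, -, hL⟩ := exists_schattenPow_tangent (p := p) (by linarith) X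
    have h1 := hL hp (X + Y) (x + h)
      (fun i => (singularValues_le_opSchattenNorm hp0 X i).trans (by linarith))
      (fun i => (singularValues_le_opSchattenNorm hp0 _ i).trans hax)
    have h2 := hL hp (X - Y) (x + h)
      (fun i => (singularValues_le_opSchattenNorm hp0 X i).trans (by linarith))
      (fun i => (singularValues_le_opSchattenNorm hp0 _ i).trans hbx)
    have hneg : hsNormSq (-Y) = hsNormSq Y := by simp [hsNormSq]
    rw [add_sub_cancel_left, ← opSchattenNorm_rpow hp0.ne', ← opSchattenNorm_rpow hp0.ne',
      hh2] at h1
    rw [show X - Y - X = -Y by abel, hneg, map_neg, ← opSchattenNorm_rpow hp0.ne',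
      ← opSchattenNorm_rpow hp0.ne', hh2] at h2
    rw [← ha, ← hx] at h1
    rw [← hb, ← hx] at h2
    have hsq {c : ℝ} (hc : 0 ≤ c) (q : ℝ) : (c ^ 2) ^ (q / 2) = c ^ q := by
      rw [← Real.rpow_natCast c 2, ← Real.rpow_mul hc]
      congr 1
      push_cast
      ring
    -- The tangent of s^(p/2) at s = x² converts the bound on a^p + b^p into one on a² + b².
    have t1 := rpow_tangent_le (q := p / 2) (by linarith) (sq_nonneg x) (sq_nonneg a)
    have t2 := rpow_tangent_le (q := p / 2) (by linarith) (sq_nonneg x) (sq_nonneg b)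
    rw [show p / 2 - 1 = (p - 2) / 2 by ring, hsq hx0, hsq hx0] at t1 t2
    rw [hsq ha0] at t1
    rw [hsq hb0] at t2
    have hM : (x + h) ^ (p - 2) ≤ 2 ^ (p - 2) * x ^ (p - 2) := by
      rw [← Real.mul_rpow (by norm_num) hx0]
      exact Real.rpow_le_rpow (by positivity) (by linarith) (by linarith)
    have hxq : 0 < x ^ (p - 2) := Real.rpow_pos_of_pos hxp _
    have hp2 : (2 : ℝ) ^ p = 4 * 2 ^ (p - 2) := by
      rw [Real.rpow_sub (by norm_num)]
      norm_num
      ring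
    have h3 : x ^ (p - 2) * (p / 2 * (a ^ 2 + b ^ 2 - 2 * x ^ 2)) ≤
        x ^ (p - 2) * (p / 2 * (p * 2 ^ p * h ^ 2)) := by
      have := mul_le_mul_of_nonneg_left hM (show 0 ≤ 2 * p ^ 2 * h ^ 2 by positivity)
      rw [hp2]
      linarith
    have h4 := le_of_mul_le_mul_left (le_of_mul_le_mul_left h3 hxq) (by positivity)
    have h5 : p * 2 ^ p ≤ P * 2 ^ P := by
      gcongr
      · linarith
      · norm_num
    have := mul_le_mul_of_nonneg_right h5 (sq_nonneg h)
    nlinarith [sq_nonneg h]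

theorem opSchattenNorm_one_eq (T : E →ₗ[ℝ] E) :
    opSchattenNorm 1 T = T.singularValues.sum fun _ s => s := by
  simp [opSchattenNorm, schattenPow]

theorem opSchattenNorm_one_eq_sum (T : E →ₗ[ℝ] E) :
    opSchattenNorm 1 T = ∑ i : Fin (finrank ℝ E), T.singularValues i := by
  rw [opSchattenNorm, schattenPow_eq_sum one_ne_zero]
  simp

/-- The number of nonzero singular values is the rank, and each is at most `c`. -/
theorem opSchattenNorm_one_le {T : E →ₗ[ℝ] E} {c : ℝ} (hc0 : 0 ≤ c) {k : ℕ}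
    (hk : finrank ℝ (range T) ≤ k) (hc : ∀ x, ‖T x‖ ≤ c * ‖x‖) : opSchattenNorm 1 T ≤ c * k := by
  obtain ⟨u, v, hT⟩ := exists_svd T
  have hσ (i : Fin (finrank ℝ E)) : T.singularValues i ≤ c := by
    have := hc (v i)
    rwa [(hT i).1, norm_smul, u.norm_eq_one, v.norm_eq_one, mul_one, mul_one, Real.norm_eq_abs,
      abs_of_nonneg (T.singularValues_nonneg i)] at this
  rw [opSchattenNorm_one_eq, Finsupp.sum]
  refine (Finset.sum_le_card_nsmul _ _ c fun i hi => ?_).trans ?_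
  · rcases lt_or_ge i (finrank ℝ E) with h | h
    · exact hσ ⟨i, h⟩
    · rw [T.singularValues_of_finrank_le h]
      exact hc0
  · rw [card_support_singularValues, nsmul_eq_mul, mul_comm]
    gcongr

end SchattenNorm

/-! ### Convex functions with bounded second differences -/

section Smooth

variable {V : Type*} [NormedAddCommGroup V] [NormedSpace ℝ V]

/-- A continuous convex function has a subgradient everywhere. -/
theorem exists_subgradient {f : V → ℝ} (hf : ConvexOn ℝ Set.univ f) (hc : Continuous f) (R : V) :
    ∃ G : V →L[ℝ] ℝ, ∀ S, f R + G S ≤ f (R + S) := by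
  have hopen : IsOpen {q : V × ℝ | f q.1 < q.2} :=
    isOpen_lt (hc.comp continuous_fst) continuous_snd
  have hconv : Convex ℝ {q : V × ℝ | f q.1 < q.2} := by
    have := hf.convex_strict_epigraph
    simpa using this
  obtain ⟨φ, hφ⟩ := geometric_hahn_banach_open_point hconv hopen
    (x := (R, f R)) (by simp)
  set c := φ (0, 1) with hcdef
  have hsplit (x : V) (r : ℝ) : φ (x, r) = φ (x, 0) + r * c := by
    rw [hcdef, ← smul_eq_mul, ← map_smul, ← map_add]
    simp
  -- The separating hyperplane is not vertical; dividing by `-c` turns it into the graph of an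
  -- affine minorant.
  have hc0 : c < 0 := by
    have := hφ (R, f R + 1) (by simp)
    rw [hsplit, hsplit R (f R)] at this
    linarith
  refine ⟨(-c)⁻¹ • φ.comp (ContinuousLinearMap.inl ℝ V ℝ), fun S => ?_⟩
  have hle : φ (R + S, f (R + S)) ≤ φ (R, f R) := by
    refine le_of_forall_pos_lt_add fun η hη => ?_
    have := hφ (R + S, f (R + S) + η / (-c)) (by
      have : 0 < η / (-c) := div_pos hη (by linarith)
      simpa using this)
    rw [hsplit] at this ⊢
    have e : η / (-c) * c = -η := by rw [div_neg, neg_mul, div_mul_cancel₀ _ hc0.ne]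
    linarith
  rw [hsplit, hsplit R, show ((R + S, 0) : V × ℝ) = (R, 0) + (S, 0) by simp, map_add] at hle
  simp only [smul_apply, ContinuousLinearMap.comp_apply,
    ContinuousLinearMap.inl_apply, smul_eq_mul]
  rw [← sub_nonneg]
  have h2 : 0 ≤ (-c)⁻¹ * ((-c) * (f (R + S) - f R) - φ (S, 0)) :=
    mul_nonneg (inv_nonneg.2 (by linarith)) (by linarith)
  rw [mul_sub, ← mul_assoc, inv_mul_cancel₀ (by linarith)] at h2
  linarith

/-- A convex function with quadratically bounded symmetric second differences is differentiable,
and its first order expansions are two-sided bounds. -/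
theorem exists_hasFDerivAt_of_convexOn {f q : V → ℝ} (hf : ConvexOn ℝ Set.univ f)
    (hc : Continuous f) {K : ℝ} (hq : ∀ S, q S ≤ K * ‖S‖ ^ 2)
    (hmid : ∀ R S, f (R + S) + f (R - S) ≤ 2 * f R + q S) (R : V) :
    ∃ G : V →L[ℝ] ℝ, HasFDerivAt f G R ∧ (∀ S, f R + G S ≤ f (R + S)) ∧
      ∀ S, f (R + S) ≤ f R + G S + q S := by
  obtain ⟨G, hG⟩ := exists_subgradient hf hc R
  -- The subgradient bounds f(R - S) from below; the second difference bound then controls f(R + S)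
  -- from above.
  have hup (S) : f (R + S) ≤ f R + G S + q S := by
    have h1 := hG (-S)
    have h2 := hmid R S
    rw [map_neg, ← sub_eq_add_neg R] at h1
    linarith
  refine ⟨G, ?_, hG, hup⟩
  rw [hasFDerivAt_iff_isLittleO_nhds_zero]
  have hO : (fun S => f (R + S) - f R - G S) =O[nhds 0] fun S => ‖S‖ ^ 2 := by
    refine Asymptotics.IsBigO.of_bound K (Filter.Eventually.of_forall fun S => ?_)
    rw [Real.norm_eq_abs, abs_of_nonneg (by linarith [hG S]), norm_pow, norm_norm]
    linarith [hup S, hq S]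
  refine hO.trans_isLittleO ?_
  refine Asymptotics.IsLittleO.of_norm_right ?_
  have := Asymptotics.isLittleO_pow_pow (𝕜 := ℝ) (m := 1) (n := 2) (by norm_num)
  have h2 := this.comp_tendsto (tendsto_norm_zero (E := V))
  simpa [Function.comp_def] using h2

theorem exists_norm_apply_le [FiniteDimensional ℝ V] {W : Type*} [NormedAddCommGroup W]
    [NormedSpace ℝ W] (Λ : V →ₗ[ℝ] W) : ∃ C : ℝ, ∀ x, ‖Λ x‖ ≤ C * ‖x‖ :=
  ⟨_, (LinearMap.toContinuousLinearMap Λ).le_opNorm⟩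

end Smooth

/-! ### Differentiability on matrix spaces -/

section MatrixSmooth

variable {n : Type*} [Fintype n]

/-- `exists_hasFDerivAt_of_convexOn` on a space of matrices, which has no canonical norm. -/
theorem exists_hasFDerivAt_of_convexOn_matrix [DecidableEq n] {f q : Matrix n n ℝ → ℝ}
    (hf : ConvexOn ℝ Set.univ f) {K : ℝ} (hK : 0 ≤ K)
    (hq : ∀ S, q S ≤ K * ‖Matrix.toEuclideanCLM (𝕜 := ℝ) S‖ ^ 2)
    (hmid : ∀ R S, f (R + S) + f (R - S) ≤ 2 * f R + q S) (R : Matrix n n ℝ) :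
    ∃ G : Matrix n n ℝ →L[ℝ] ℝ, HasFDerivAt f G R ∧ (∀ S, f R + G S ≤ f (R + S)) ∧
      ∀ S, f (R + S) ≤ f R + G S + q S := by
  let _ : NormedAddCommGroup (Matrix n n ℝ) := Matrix.normedAddCommGroup
  let _ : NormedSpace ℝ (Matrix n n ℝ) := Matrix.normedSpace
  have hc : Continuous f := by
    rw [← continuousOn_univ]
    exact hf.continuousOn isOpen_univ
  obtain ⟨C, hC⟩ := exists_norm_apply_le
    (Matrix.toEuclideanCLM (n := n) (𝕜 := ℝ)).toAlgEquiv.toLinearEquiv.toLinearMap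
  refine exists_hasFDerivAt_of_convexOn hf hc (K := K * C ^ 2) (fun S => (hq S).trans ?_) hmid R
  rw [mul_assoc, ← mul_pow]
  have : ‖Matrix.toEuclideanCLM (𝕜 := ℝ) S‖ ≤ C * ‖S‖ := hC S
  gcongr

/-- A run comes with its own differential; uniqueness identifies it with the one for which the
two-sided bounds hold. The auxiliary norm serves only the proof. -/
theorem hasFDerivAt_matrix_unique {G G' : Matrix n n ℝ →L[ℝ] ℝ} {S : Matrix n n ℝ}
    (h : HasFDerivAt f G S) (h' : HasFDerivAt f G' S) : G = G' := by
  let _ : NormedAddCommGroup (Matrix n n ℝ) := Matrix.normedAddCommGroup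
  let _ : NormedSpace ℝ (Matrix n n ℝ) := Matrix.normedSpace
  exact HasFDerivAt.unique h h'

end MatrixSmooth

/-! ### Convexity and smoothness of the objective -/

section Objective

open LinearMap

variable {d : ℕ}

theorem schattenNorm_eq {n : Type*} [Fintype n] [DecidableEq n] (p : ℝ) (A : Matrix n n ℝ) :
    schattenNorm p A = opSchattenNorm p (Matrix.toEuclideanLin A) := rfl

theorem hsNormSq_toEuclideanLin {n : Type*} [Fintype n] [DecidableEq n] (A : Matrix n n ℝ) :
    hsNormSq (Matrix.toEuclideanLin A) = ∑ i, ∑ j, A i j ^ 2 := by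
  rw [← sum_norm_sq_eq_hsNormSq (EuclideanSpace.basisFun n ℝ), Finset.sum_comm]
  refine Finset.sum_congr rfl fun j _ => ?_
  rw [EuclideanSpace.norm_sq_eq]
  refine Finset.sum_congr rfl fun i _ => ?_
  simp [Matrix.toLpLin_apply]

/-- The reverse triangle inequality and domination by the Hilbert–Schmidt norm make it 1-Lipschitz
in the Frobenius distance. -/
theorem continuous_schattenNorm {n : Type*} [Fintype n] [DecidableEq n] {p : ℝ} (hp : 2 ≤ p) :
    Continuous (schattenNorm p : Matrix n n ℝ → ℝ) := by
  rw [continuous_iff_continuousAt]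
  intro A
  have h0 : Filter.Tendsto (fun B : Matrix n n ℝ => √(∑ i, ∑ j, (B - A) i j ^ 2)) (nhds A)
      (nhds 0) := by
    have : Continuous fun B : Matrix n n ℝ => √(∑ i, ∑ j, (B - A) i j ^ 2) := by
      simp only [Matrix.sub_apply]
      fun_prop
    have h := this.tendsto A
    simpa using h
  refine tendsto_iff_dist_tendsto_zero.2
    (squeeze_zero (fun _ => dist_nonneg) (fun B => ?_) h0)
  rw [Real.dist_eq, schattenNorm_eq, schattenNorm_eq]
  refine (abs_opSchattenNorm_sub_le (by linarith) _ _).trans ?_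
  rw [← map_sub, ← hsNormSq_toEuclideanLin]
  exact opSchattenNorm_le_sqrt_hsNormSq hp _

theorem integrable_of_continuous_of_ae_norm_eq_one {μ : Measure (EuclideanSpace ℝ (Fin d))}
    [IsProbabilityMeasure μ] (hμ : ∀ᵐ x ∂μ, ‖x‖ = 1) {g : EuclideanSpace ℝ (Fin d) → ℝ}
    (hg : Continuous g) : Integrable g μ := by
  obtain ⟨C, hC⟩ := (isCompact_sphere (0 : EuclideanSpace ℝ (Fin d)) 1).exists_bound_of_continuousOn
    hg.continuousOn
  exact Integrable.of_bound hg.aestronglyMeasurable C (hμ.mono fun x hx => hC x (by simpa using hx))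

theorem continuous_tensorSq : Continuous (tensorSq : EuclideanSpace ℝ (Fin d) → _) := by
  unfold tensorSq
  fun_prop

theorem continuous_schattenError {p : ℝ} (hp : 2 ≤ p)
    (R : Matrix (Fin d × Fin d) (Fin d × Fin d) ℝ) : Continuous (schattenError p R) := by
  refine (continuous_schattenNorm hp).comp ?_
  have h : Continuous fun x : EuclideanSpace ℝ (Fin d) => R *ᵥ tensorSq x - tensorSq x :=
    (continuous_const.matrix_mulVec continuous_tensorSq).sub continuous_tensorSq
  exact continuous_pi fun i => continuous_pi fun j => (continuous_apply (i, j)).comp h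

theorem norm_tensorSq (x : EuclideanSpace ℝ (Fin d)) :
    ‖WithLp.toLp 2 (tensorSq x)‖ = ‖x‖ ^ 2 := by
  rw [← sq_eq_sq₀ (norm_nonneg _) (sq_nonneg _), EuclideanSpace.norm_sq_eq, Fintype.sum_prod_type,
    sq (‖x‖ ^ 2), EuclideanSpace.norm_sq_eq, Finset.sum_mul_sum]
  simp [tensorSq, mul_pow]

/-- The map `S ↦ S x^{⊗2}`, with values viewed as operators. -/
noncomputable def liftedApply (x : EuclideanSpace ℝ (Fin d)) :
    Matrix (Fin d × Fin d) (Fin d × Fin d) ℝ →ₗ[ℝ]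
      (EuclideanSpace ℝ (Fin d) →ₗ[ℝ] EuclideanSpace ℝ (Fin d)) where
  toFun S := Matrix.toEuclideanLin (unlift (S *ᵥ tensorSq x))
  map_add' S S' := by
    rw [← map_add]
    congr 1
    ext i j
    simp [unlift, Matrix.add_mulVec]
  map_smul' c S := by
    rw [RingHom.id_apply, ← map_smul]
    congr 1
    ext i j
    simp [unlift, Matrix.smul_mulVec]

/-- Reshaping a vector into a matrix preserves the sum of squares, so this energy is controlled by
the operator norm of `S`. -/
theorem hsNormSq_liftedApply (x : EuclideanSpace ℝ (Fin d))
    (S : Matrix (Fin d × Fin d) (Fin d × Fin d) ℝ) :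
    hsNormSq (liftedApply x S) = ‖Matrix.toEuclideanLin S (WithLp.toLp 2 (tensorSq x))‖ ^ 2 := by
  rw [EuclideanSpace.norm_sq_eq, Fintype.sum_prod_type]
  change hsNormSq (Matrix.toEuclideanLin (unlift (S *ᵥ tensorSq x))) = _
  rw [hsNormSq_toEuclideanLin]
  simp [unlift]

/-- The error is a norm of a linear image of `R - 1`, so convexity and smoothness in `R` are
inherited pointwise in `x`. -/
theorem schattenError_eq (p : ℝ) (R : Matrix (Fin d × Fin d) (Fin d × Fin d) ℝ)
    (x : EuclideanSpace ℝ (Fin d)) :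
    schattenError p R x = opSchattenNorm p (liftedApply x (R - 1)) := by
  simp only [schattenError, schattenNorm_eq, liftedApply, LinearMap.coe_mk, AddHom.coe_mk,
    Matrix.sub_mulVec, Matrix.one_mulVec]

variable {μ : Measure (EuclideanSpace ℝ (Fin d))} [IsProbabilityMeasure μ]

theorem integrable_schattenError (hμ : ∀ᵐ x ∂μ, ‖x‖ = 1) {p : ℝ} (hp : 2 ≤ p)
    (R : Matrix (Fin d × Fin d) (Fin d × Fin d) ℝ) :
    Integrable (fun x => schattenError p R x) μ :=
  integrable_of_continuous_of_ae_norm_eq_one hμ (continuous_schattenError hp R)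

theorem integrable_schattenError_sq (hμ : ∀ᵐ x ∂μ, ‖x‖ = 1) {p : ℝ} (hp : 2 ≤ p)
    (R : Matrix (Fin d × Fin d) (Fin d × Fin d) ℝ) :
    Integrable (fun x => schattenError p R x ^ 2) μ :=
  integrable_of_continuous_of_ae_norm_eq_one hμ ((continuous_schattenError hp R).pow 2)

theorem convexOn_objective (hμ : ∀ᵐ x ∂μ, ‖x‖ = 1) {p : ℝ} (hp : 2 ≤ p) :
    ConvexOn ℝ Set.univ (objective p μ) := by
  refine ⟨convex_univ, fun R _ S _ a b ha hb hab => ?_⟩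
  have hR := integrable_schattenError_sq hμ hp R
  have hS := integrable_schattenError_sq hμ hp S
  simp only [objective, smul_eq_mul]
  rw [← integral_const_mul, ← integral_const_mul, ← integral_add (hR.const_mul a) (hS.const_mul b)]
  refine integral_mono (integrable_schattenError_sq hμ hp _)
    ((hR.const_mul a).add (hS.const_mul b)) fun x => ?_
  have e : a • R + b • S - 1 = a • (R - 1) + b • (S - 1) := by
    rw [smul_sub, smul_sub, sub_add_sub_comm, ← add_smul, hab, one_smul]
  simp only [schattenError_eq, e, map_add, map_smul]
  exact opSchattenNorm_sq_convex (by linarith) _ _ ha hb hab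

/-- The quadratic error term in the first order expansion of the objective. -/
noncomputable def liftedEnergy (μ : Measure (EuclideanSpace ℝ (Fin d)))
    (S : Matrix (Fin d × Fin d) (Fin d × Fin d) ℝ) : ℝ :=
  ∫ x, hsNormSq (liftedApply x S) ∂μ

theorem integrable_hsNormSq_liftedApply (hμ : ∀ᵐ x ∂μ, ‖x‖ = 1)
    (S : Matrix (Fin d × Fin d) (Fin d × Fin d) ℝ) :
    Integrable (fun x => hsNormSq (liftedApply x S)) μ := by
  refine integrable_of_continuous_of_ae_norm_eq_one hμ ?_
  simp only [hsNormSq_liftedApply]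
  refine (Continuous.norm ?_).pow 2
  exact (LinearMap.continuous_of_finiteDimensional _).comp
    ((PiLp.continuous_toLp 2 _).comp continuous_tensorSq)

theorem liftedEnergy_le (hμ : ∀ᵐ x ∂μ, ‖x‖ = 1) {S : Matrix (Fin d × Fin d) (Fin d × Fin d) ℝ}
    {c : ℝ} (hS : ∀ z, ‖Matrix.toEuclideanLin S z‖ ≤ c * ‖z‖) : liftedEnergy μ S ≤ c ^ 2 := by
  have : ∫ x, hsNormSq (liftedApply x S) ∂μ ≤ ∫ _, c ^ 2 ∂μ := by
    refine integral_mono_ae (integrable_hsNormSq_liftedApply hμ S) (integrable_const _) ?_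
    filter_upwards [hμ] with x hx
    have h := hS (WithLp.toLp 2 (tensorSq x))
    rw [norm_tensorSq, hx, one_pow, mul_one] at h
    rw [hsNormSq_liftedApply]
    exact pow_le_pow_left₀ (norm_nonneg _) h 2
  simpa [liftedEnergy] using this

theorem objective_add_add_objective_sub_le (hμ : ∀ᵐ x ∂μ, ‖x‖ = 1) {p P : ℝ} (hp : 2 ≤ p)
    (hpP : p ≤ P) (R S : Matrix (Fin d × Fin d) (Fin d × Fin d) ℝ) :
    objective p μ (R + S) + objective p μ (R - S) ≤
      2 * objective p μ R + (8 + P * 2 ^ P) * liftedEnergy μ S := by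
  have h1 := integrable_schattenError_sq hμ hp (R + S)
  have h2 := integrable_schattenError_sq hμ hp (R - S)
  have h3 := (integrable_schattenError_sq hμ hp R).const_mul 2
  have h4 := (integrable_hsNormSq_liftedApply hμ S).const_mul (8 + P * 2 ^ P)
  simp only [objective, liftedEnergy]
  rw [← integral_const_mul, ← integral_const_mul, ← integral_add h1 h2, ← integral_add h3 h4]
  refine integral_mono (h1.add h2) (h3.add h4) fun x => ?_
  simp only [schattenError_eq, add_sub_right_comm R S 1, sub_right_comm R S 1, map_add, map_sub]
  rw [← map_sub (liftedApply x) R 1]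
  exact opSchattenNorm_sq_add_sq_sub_le hp hpP _ _

/-- The objective is convex and smooth, with an explicit quadratic error. -/
theorem exists_hasFDerivAt_objective (hμ : ∀ᵐ x ∂μ, ‖x‖ = 1) {p P : ℝ} (hp : 2 ≤ p)
    (hpP : p ≤ P) (R : Matrix (Fin d × Fin d) (Fin d × Fin d) ℝ) :
    ∃ G : Matrix (Fin d × Fin d) (Fin d × Fin d) ℝ →L[ℝ] ℝ, HasFDerivAt (objective p μ) G R ∧
      (∀ S, objective p μ R + G S ≤ objective p μ (R + S)) ∧
      ∀ S, objective p μ (R + S) ≤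
        objective p μ R + G S + (8 + P * 2 ^ P) * liftedEnergy μ S := by
  have hK : 0 ≤ 8 + P * 2 ^ P := by
    have : 0 ≤ P * 2 ^ P := mul_nonneg (by linarith) (by positivity)
    linarith
  refine exists_hasFDerivAt_of_convexOn_matrix (convexOn_objective hμ hp) hK (fun S => ?_)
    (objective_add_add_objective_sub_le hμ hp hpP) R
  refine mul_le_mul_of_nonneg_left (liftedEnergy_le hμ fun z => ?_) hK
  exact (Matrix.toEuclideanCLM (𝕜 := ℝ) S).le_opNorm z

end Objective

/-! ### Frank–Wolfe runs: existence, rank and convergence rate -/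

section FrankWolfe

open LinearMap

variable {n : Type*} [Fintype n] [DecidableEq n]

theorem toEuclideanLin_vecMulVec (a b : EuclideanSpace ℝ n) (x : EuclideanSpace ℝ n) :
    Matrix.toEuclideanLin (Matrix.vecMulVec (fun i => a i) fun i => b i) x
      = inner ℝ b x • a := by
  ext i
  simp only [Matrix.toLpLin_apply, Matrix.mulVec, dotProduct, Matrix.vecMulVec_apply,
    PiLp.smul_apply, smul_eq_mul, PiLp.inner_apply, Finset.sum_mul]
  exact Finset.sum_congr rfl fun j _ => by simp; ring

theorem finrank_range_toEuclideanLin (M : Matrix n n ℝ) :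
    Module.finrank ℝ (range (Matrix.toEuclideanLin M)) = M.rank := by
  rw [Matrix.rank_eq_finrank_range_toLin M (EuclideanSpace.basisFun n ℝ).toBasis
    (EuclideanSpace.basisFun n ℝ).toBasis]
  rfl

theorem exists_eq_sum_vecMulVec (S : Matrix n n ℝ) :
    ∃ u v : OrthonormalBasis (Fin (Module.finrank ℝ (EuclideanSpace ℝ n))) ℝ (EuclideanSpace ℝ n),
      S = ∑ i : Fin (Module.finrank ℝ (EuclideanSpace ℝ n)),
        (Matrix.toEuclideanLin S).singularValues i •
          Matrix.vecMulVec (fun k => u i k) fun k => v i k := by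
  obtain ⟨u, v, h⟩ := exists_svd (Matrix.toEuclideanLin S)
  refine ⟨u, v, Matrix.toEuclideanLin.injective (v.toBasis.ext fun j => ?_)⟩
  rw [v.coe_toBasis, (h j).1, map_sum, LinearMap.sum_apply, Finset.sum_eq_single j]
  · rw [map_smul, LinearMap.smul_apply, toEuclideanLin_vecMulVec, real_inner_self_eq_norm_sq,
      v.norm_eq_one]
    simp
  · intro i _ hij
    rw [map_smul, LinearMap.smul_apply, toEuclideanLin_vecMulVec, v.inner_eq_ite, if_neg hij]
    simp
  · simp

theorem schattenNorm_one_smul_vecMulVec_le {r : ℝ} (hr : 0 ≤ r) {u v : n → ℝ} (hu : u ⬝ᵥ u = 1)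
    (hv : v ⬝ᵥ v = 1) : schattenNorm 1 (r • Matrix.vecMulVec u v) ≤ r := by
  have hn {w : n → ℝ} (hw : w ⬝ᵥ w = 1) : ‖WithLp.toLp 2 w‖ = 1 := by
    rw [← sq_eq_sq₀ (norm_nonneg _) zero_le_one, EuclideanSpace.norm_sq_eq, one_pow, ← hw,
      dotProduct]
    exact Finset.sum_congr rfl fun i _ => by simp [sq]
  have h1 : Module.finrank ℝ (range (Matrix.toEuclideanLin (r • Matrix.vecMulVec u v))) ≤ 1 := by
    rw [finrank_range_toEuclideanLin, ← Matrix.smul_vecMulVec]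
    exact Matrix.rank_vecMulVec_le _ _
  have h := opSchattenNorm_one_le hr h1 fun x => by
    rw [map_smul, LinearMap.smul_apply,
      toEuclideanLin_vecMulVec (WithLp.toLp 2 u) (WithLp.toLp 2 v), norm_smul, norm_smul, hn hu,
      mul_one, Real.norm_of_nonneg hr]
    have := norm_inner_le_norm (𝕜 := ℝ) (WithLp.toLp 2 v) x
    rw [hn hv, one_mul] at this
    gcongr
  simpa [schattenNorm_eq] using h

/-- A linear functional attains its minimum over a trace norm ball at a rank one matrix. -/
theorem exists_rankOne_minimizer [Nonempty n] (G : Matrix n n ℝ →L[ℝ] ℝ) (r : ℝ) :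
    ∃ u v : n → ℝ, u ⬝ᵥ u = 1 ∧ v ⬝ᵥ v = 1 ∧
      ∀ S : Matrix n n ℝ, schattenNorm 1 S ≤ r → G (r • Matrix.vecMulVec u v) ≤ G S := by
  let K := Metric.sphere (0 : EuclideanSpace ℝ n) 1
  have hK : IsCompact (K ×ˢ K) := (isCompact_sphere _ _).prod (isCompact_sphere _ _)
  obtain ⟨e, he⟩ : K.Nonempty := NormedSpace.sphere_nonempty.2 zero_le_one
  let F : EuclideanSpace ℝ n × EuclideanSpace ℝ n → ℝ :=
    fun w => G (Matrix.vecMulVec (fun i => w.1 i) fun i => w.2 i)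
  have hF : Continuous F := by
    refine G.continuous.comp (continuous_pi fun i => continuous_pi fun j => ?_)
    simp only [Matrix.vecMulVec_apply]
    fun_prop
  obtain ⟨⟨u, v⟩, ⟨hu, hv⟩, hmin⟩ := hK.exists_isMinOn ⟨(e, e), he, he⟩ hF.continuousOn
  have hunit {w : EuclideanSpace ℝ n} (hw : w ∈ K) :
      (fun i => w i) ⬝ᵥ (fun i => w i) = 1 := by
    have h : ‖w‖ ^ 2 = 1 := by rw [mem_sphere_zero_iff_norm.1 hw, one_pow]
    rw [EuclideanSpace.norm_sq_eq] at h
    rw [← h, dotProduct]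
    exact Finset.sum_congr rfl fun i _ => by simp [sq]
  set m := F (u, v) with hm
  have hle {a b : EuclideanSpace ℝ n} (ha : ‖a‖ = 1) (hb : ‖b‖ = 1) : m ≤ F (a, b) :=
    hmin ⟨mem_sphere_zero_iff_norm.2 ha, mem_sphere_zero_iff_norm.2 hb⟩
  -- Flipping the sign of `u` negates the value. The sign of `m` is what makes enlarging ∑ σ_i to
  -- `r` lower the bound.
  have hm0 : m ≤ 0 := by
    have h1 := hle (a := -u) (b := v) (by rw [norm_neg]; exact mem_sphere_zero_iff_norm.1 hu)
      (mem_sphere_zero_iff_norm.1 hv)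
    have h2 : F (-u, v) = -m := by
      rw [hm]
      simp only [F]
      rw [← map_neg]
      congr 1
      ext i j
      simp [Matrix.vecMulVec_apply]
    linarith
  refine ⟨fun i => u i, fun i => v i, hunit hu, hunit hv, fun S hS => ?_⟩
  obtain ⟨a, b, hab⟩ := exists_eq_sum_vecMulVec S
  rw [schattenNorm_eq, opSchattenNorm_one_eq_sum] at hS
  calc G (r • Matrix.vecMulVec (fun i => u i) fun i => v i) = r * m := by
        rw [map_smul, smul_eq_mul]
    _ ≤ (∑ i : Fin (Module.finrank ℝ (EuclideanSpace ℝ n)),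
          (Matrix.toEuclideanLin S).singularValues i) * m := mul_le_mul_of_nonpos_right hS hm0
    _ ≤ ∑ i : Fin (Module.finrank ℝ (EuclideanSpace ℝ n)),
          (Matrix.toEuclideanLin S).singularValues i * F (a i, b i) := by
        rw [Finset.sum_mul]
        exact Finset.sum_le_sum fun i _ => mul_le_mul_of_nonneg_left
          (hle (a.norm_eq_one i) (b.norm_eq_one i)) (LinearMap.singularValues_nonneg _ _)
    _ = G S := by
        conv_rhs => rw [hab]
        simp only [map_sum, map_smul, smul_eq_mul, F]

theorem exists_isFrankWolfeRun [Nonempty n] {f : Matrix n n ℝ → ℝ} {r : ℝ} (hr : 0 ≤ r)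
    (hf : ∀ R, ∃ G : Matrix n n ℝ →L[ℝ] ℝ, HasFDerivAt f G R) : ∃ R, IsFrankWolfeRun f r R := by
  choose G hG using hf
  choose u v hu hv hmin using fun R => exists_rankOne_minimizer (G R) r
  let R : ℕ → Matrix n n ℝ := fun t => Nat.rec 0 (fun t S => (1 - 2 / ((t : ℝ) + 2)) • S
      + (2 / ((t : ℝ) + 2)) • (r • Matrix.vecMulVec (u S) (v S))) t
  refine ⟨R, ?_, fun t => ⟨G (R t), u (R t), v (R t), hG _, hu _, hv _, hmin _, rfl⟩⟩
  change schattenNorm 1 0 ≤ r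
  rw [schattenNorm_eq, opSchattenNorm_one_eq, map_zero, LinearMap.singularValues_zero]
  simpa using hr

variable {f : Matrix n n ℝ → ℝ} {r : ℝ} {R : ℕ → Matrix n n ℝ}

theorem two_div_add_two_mem (t : ℕ) : 0 ≤ 2 / ((t : ℝ) + 2) ∧ 2 / ((t : ℝ) + 2) ≤ 1 := by
  refine ⟨by positivity, ?_⟩
  rw [div_le_one (by positivity)]
  linarith [t.cast_nonneg (α := ℝ)]

theorem radius_nonneg_of_schattenNorm_le {S : Matrix n n ℝ} (hS : schattenNorm 1 S ≤ r) : 0 ≤ r :=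
  (opSchattenNorm_nonneg _ _).trans hS

theorem IsFrankWolfeRun.schattenNorm_le (h : IsFrankWolfeRun f r R) (t : ℕ) :
    schattenNorm 1 (R t) ≤ r := by
  induction t with
  | zero => exact h.start
  | succ t ih =>
    obtain ⟨G, u, v, -, hu, hv, -, hR⟩ := h.step t
    obtain ⟨h0, h1⟩ := two_div_add_two_mem t
    have hV := schattenNorm_one_smul_vecMulVec_le (radius_nonneg_of_schattenNorm_le h.start) hu hv
    rw [hR]
    set γ := 2 / ((t : ℝ) + 2)
    rw [schattenNorm_eq] at ih hV ⊢
    rw [map_add, map_smul, map_smul]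
    refine (opSchattenNorm_add_le le_rfl _ _).trans ?_
    rw [opSchattenNorm_smul one_ne_zero, opSchattenNorm_smul one_ne_zero, abs_of_nonneg h0,
      abs_of_nonneg (sub_nonneg.2 h1)]
    have := mul_le_mul_of_nonneg_left ih (sub_nonneg.2 h1)
    have := mul_le_mul_of_nonneg_left hV h0
    linarith

/-- After `t + 1` steps the iterate is a sum of `t + 1` rank one matrices. -/
theorem IsFrankWolfeRun.exists_eq_sum (h : IsFrankWolfeRun f r R) (t : ℕ) :
    ∃ a b : Fin (t + 1) → n → ℝ, R (t + 1) = ∑ s, Matrix.vecMulVec (a s) (b s) := by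
  induction t with
  | zero =>
    obtain ⟨G, u, v, -, -, -, -, hR⟩ := h.step 0
    -- The step size at t = 0 is 1, so the start disappears whatever its rank.
    refine ⟨fun _ => r • u, fun _ => v, ?_⟩
    rw [hR]
    simp [Matrix.smul_vecMulVec]
  | succ t ih =>
    obtain ⟨a, b, hab⟩ := ih
    obtain ⟨G, u, v, -, -, -, -, hR⟩ := h.step (t + 1)
    set γ := 2 / (((t + 1 : ℕ) : ℝ) + 2)
    refine ⟨Fin.snoc (α := fun _ => n → ℝ) (fun s => (1 - γ) • a s) (γ • r • u),
      Fin.snoc (α := fun _ => n → ℝ) b v, ?_⟩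
    rw [hR, hab, Fin.sum_univ_castSucc (n := t + 1)]
    simp only [Fin.snoc_castSucc, Fin.snoc_last, Matrix.smul_vecMulVec, Finset.smul_sum]

/-- The start is an arbitrary feasible matrix, so at t = 0 it factors through dimension 0 only when
the ball is reduced to zero. -/
theorem IsFrankWolfeRun.exists_mul_eq (h : IsFrankWolfeRun f r R) {t : ℕ} (ht : t ≠ 0 ∨ r ≤ 0) :
    ∃ (A : Matrix (Fin t) n ℝ) (B : Matrix n (Fin t) ℝ), B * A = R t := by
  rcases t with _ | t
  · have hr := ht.resolve_left (by simp)
    have h0 : Matrix.toEuclideanLin (R 0) = 0 := by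
      ext1 x
      have := norm_apply_le_opSchattenNorm one_pos (Matrix.toEuclideanLin (R 0)) x
      have h2 : opSchattenNorm 1 (Matrix.toEuclideanLin (R 0)) ≤ 0 := h.start.trans hr
      have h3 := mul_le_mul_of_nonneg_right h2 (norm_nonneg x)
      rw [zero_mul] at h3
      simpa using this.trans h3
    refine ⟨0, 0, ?_⟩
    rw [Matrix.mul_zero]
    exact (Matrix.toEuclideanLin.injective (by rw [h0, map_zero])).symm
  · obtain ⟨a, b, hab⟩ := h.exists_eq_sum t
    refine ⟨Matrix.of b, (Matrix.of a)ᵀ, ?_⟩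
    rw [hab]
    ext i j
    simp [Matrix.mul_apply, Matrix.sum_apply, Matrix.vecMulVec_apply]

/-- No bound on `h 0` is needed, as its coefficient 1 - 2/2 vanishes. The induction step comes down
to (t + 2)(t + 4) ≤ (t + 3)². -/
theorem le_four_mul_div_of_recurrence {h : ℕ → ℝ} {c : ℝ} (hc : 0 ≤ c)
    (hh : ∀ t : ℕ, h (t + 1) ≤ (1 - 2 / ((t : ℝ) + 2)) * h t + (2 / ((t : ℝ) + 2)) ^ 2 * c)
    (t : ℕ) : h (t + 1) ≤ 4 * c / ((t : ℝ) + 3) := by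
  induction t with
  | zero =>
    have := hh 0
    norm_num at this ⊢
    linarith
  | succ t ih =>
    have h1 := hh (t + 1)
    push_cast at h1 ⊢
    have ht : (0 : ℝ) ≤ t := t.cast_nonneg
    have h2 : 0 ≤ 1 - 2 / ((t : ℝ) + 1 + 2) := by
      rw [sub_nonneg, div_le_one (by positivity)]
      linarith
    have h3 := mul_le_mul_of_nonneg_left ih h2
    have h4 : (1 - 2 / ((t : ℝ) + 1 + 2)) * (4 * c / ((t : ℝ) + 3))
        + (2 / ((t : ℝ) + 1 + 2)) ^ 2 * c = 4 * c * (((t : ℝ) + 2) / ((t : ℝ) + 3) ^ 2) := by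
      rw [show (t : ℝ) + 1 + 2 = t + 3 by ring]
      field_simp
      ring
    have h5 : ((t : ℝ) + 2) / ((t : ℝ) + 3) ^ 2 ≤ 1 / ((t : ℝ) + 1 + 3) := by
      rw [div_le_div_iff₀ (by positivity) (by positivity)]
      nlinarith
    have h6 := mul_le_mul_of_nonneg_left h5 (show 0 ≤ 4 * c by linarith)
    rw [mul_one_div] at h6
    linarith

/-- The convergence rate of the Frank-Wolfe algorithm, for a convex function whose first order
expansions have error at most `q`. -/
theorem IsFrankWolfeRun.sub_le (h : IsFrankWolfeRun f r R) {q : Matrix n n ℝ → ℝ} {c : ℝ}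
    (hf : ∀ S, ∃ G : Matrix n n ℝ →L[ℝ] ℝ, HasFDerivAt f G S ∧ (∀ D, f S + G D ≤ f (S + D)) ∧
      ∀ D, f (S + D) ≤ f S + G D + q D) (hc : 0 ≤ c)
    (hq : ∀ S V : Matrix n n ℝ, schattenNorm 1 S ≤ r → schattenNorm 1 V ≤ r → ∀ γ : ℝ,
      q (γ • (V - S)) ≤ γ ^ 2 * c)
    {S : Matrix n n ℝ} (hS : schattenNorm 1 S ≤ r) (t : ℕ) :
    f (R (t + 1)) - f S ≤ 4 * c / ((t : ℝ) + 3) := by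
  refine le_four_mul_div_of_recurrence (h := fun t => f (R t) - f S) hc (fun t => ?_) t
  obtain ⟨G, u, v, hG, hu, hv, hmin, hR⟩ := h.step t
  obtain ⟨G', hG', hlow, hup⟩ := hf (R t)
  obtain rfl := hasFDerivAt_matrix_unique hG hG'
  obtain ⟨h0, -⟩ := two_div_add_two_mem t
  set γ := 2 / ((t : ℝ) + 2)
  set V := r • Matrix.vecMulVec u v
  have hV : schattenNorm 1 V ≤ r :=
    schattenNorm_one_smul_vecMulVec_le (radius_nonneg_of_schattenNorm_le hS) hu hv
  have e : R (t + 1) = R t + γ • (V - R t) := by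
    rw [hR, sub_smul, one_smul, smul_sub]
    abel
  have h1 := hup (γ • (V - R t))
  have h2 := hlow (S - R t)
  have h3 := hmin S hS
  have h4 := hq (R t) V (h.schattenNorm_le t) hV γ
  rw [← e, map_smul, smul_eq_mul, map_sub] at h1
  rw [add_sub_cancel, map_sub] at h2
  -- Minimality of `V` and convexity: G(V - R t) ≤ G(S - R t) ≤ f S - f(R t).
  have h5 := mul_le_mul_of_nonneg_left (show G V - G (R t) ≤ f S - f (R t) by linarith) h0
  linarith

end FrankWolfe

/-! ### Perturbation of the top right-singular vector -/

section Decoder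

variable {E : Type*} [NormedAddCommGroup E] [InnerProductSpace ℝ E]

/-- This is T*T v = ‖T v‖² v in weak form. The form ‖T v‖²‖w‖² - ‖T w‖² is nonnegative and vanishes
at w = v, so its derivative there vanishes. -/
theorem inner_apply_eq_of_isMax {T : E →ₗ[ℝ] E} {v : E} (hv : ‖v‖ = 1)
    (hmax : ∀ w, ‖w‖ = 1 → ‖T w‖ ≤ ‖T v‖) (y : E) :
    inner ℝ (T v) (T y) = ‖T v‖ ^ 2 * inner ℝ v y := by
  have hall (w : E) : ‖T w‖ ≤ ‖T v‖ * ‖w‖ := by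
    rcases eq_or_ne w 0 with rfl | hw
    · simp
    · have hw' : 0 < ‖w‖ := norm_pos_iff.2 hw
      have h := hmax (‖w‖⁻¹ • w) (by rw [norm_smul, norm_inv, norm_norm, inv_mul_cancel₀ hw'.ne'])
      rwa [map_smul, norm_smul, norm_inv, norm_norm, inv_mul_le_iff₀ hw', mul_comm] at h
  set a := inner ℝ (T v) (T y) - ‖T v‖ ^ 2 * inner ℝ v y with ha
  set b := ‖T y‖ ^ 2 - ‖T v‖ ^ 2 * ‖y‖ ^ 2 with hb
  have key (t : ℝ) : 2 * t * a + t ^ 2 * b ≤ 0 := by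
    have h := pow_le_pow_left₀ (norm_nonneg _) (hall (v + t • y)) 2
    rw [mul_pow, map_add, map_smul, norm_add_sq_real, norm_add_sq_real, inner_smul_right,
      inner_smul_right, norm_smul, norm_smul, mul_pow, mul_pow, Real.norm_eq_abs, sq_abs, hv] at h
    rw [ha, hb]
    linarith
  -- With t = a/(|b| + 1) the linear term of `key` dominates the quadratic one, which forces a = 0.
  have hpos : 0 < |b| + 1 := by positivity
  have h1 := key (a / (|b| + 1))
  have h2 : 2 * (a / (|b| + 1)) * a + (a / (|b| + 1)) ^ 2 * b
      = (a / (|b| + 1)) ^ 2 * (2 * (|b| + 1) + b) := by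
    field_simp
  rw [h2] at h1
  have h3 : 0 < 2 * (|b| + 1) + b := by linarith [neg_abs_le b, abs_nonneg b]
  have h4 : (a / (|b| + 1)) ^ 2 = 0 :=
    le_antisymm (nonpos_of_mul_nonpos_left h1 h3) (sq_nonneg _)
  have h5 : a = 0 := by
    rcases div_eq_zero_iff.1 (pow_eq_zero_iff two_ne_zero |>.1 h4) with h | h
    · exact h
    · exact absurd h hpos.ne'
  linarith

/-- Perturbation bound for the top right-singular vector of a rank one projection. -/
theorem min_norm_sub_sq_le {T : E →ₗ[ℝ] E} {x v : E} {e : ℝ} (hx : ‖x‖ = 1) (hv : ‖v‖ = 1)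
    (hmax : ∀ w, ‖w‖ = 1 → ‖T w‖ ≤ ‖T v‖) (hT : ∀ y, ‖T y - inner ℝ x y • x‖ ≤ e * ‖y‖) :
    min (‖v - x‖ ^ 2) (‖v + x‖ ^ 2) ≤ 8 * e ^ 2 := by
  set c := inner ℝ v x with hc
  have h1 : ‖v - x‖ ^ 2 = 2 - 2 * c := by
    rw [norm_sub_sq_real, hx, hv]; ring
  have h2 : ‖v + x‖ ^ 2 = 2 + 2 * c := by
    rw [norm_add_sq_real, hx, hv]; ring
  have he0 : 0 ≤ e := by
    have := (norm_nonneg _).trans (hT x)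
    rwa [hx, mul_one] at this
  have hc1 : |c| ≤ 1 := by
    have := abs_real_inner_le_norm v x
    rwa [hx, hv, mul_one] at this
  rw [h1, h2]
  suffices h : 2 - 2 * |c| ≤ 8 * e ^ 2 by
    rcases abs_cases c with ⟨hh, -⟩ | ⟨hh, -⟩
    · exact (min_le_left _ _).trans (by linarith)
    · exact (min_le_right _ _).trans (by linarith)
  have hcc := abs_nonneg c
  -- For e ≥ 1/2 the bound is trivial, as 8e² ≥ 2. For e < 1/2, ‖T v‖ ≥ ‖T x‖ ≥ 1 - e > 1/2.
  rcases le_or_gt (1 / 2) e with he | he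
  · nlinarith
  · set y := v - c • x with hy
    have hxy : inner ℝ x y = 0 := by
      rw [hy, inner_sub_right, inner_smul_right, real_inner_self_eq_norm_sq, hx, real_inner_comm]
      ring
    have hvy : inner ℝ v y = ‖y‖ ^ 2 := by
      rw [← real_inner_self_eq_norm_sq]
      nth_rw 2 [hy]
      rw [inner_sub_left, inner_smul_left, hxy]
      simp
    have hyy : ‖y‖ ^ 2 = 1 - c ^ 2 := by
      rw [hy, norm_sub_sq_real, inner_smul_right, norm_smul, hx, hv, mul_one, Real.norm_eq_abs,
        sq_abs, ← hc]
      ring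
    have hσ : 1 / 2 < ‖T v‖ := by
      have h3 := hT x
      rw [real_inner_self_eq_norm_sq, hx, one_pow, one_smul, mul_one] at h3
      have h4 := norm_sub_norm_le x (T x)
      rw [norm_sub_rev, hx] at h4
      linarith [hmax x hx]
    have hTy : ‖T y‖ ≤ e * ‖y‖ := by
      have := hT y
      rwa [hxy, zero_smul, sub_zero] at this
    -- Here `y` is the part of `v` orthogonal to `x`, on which T is small: ‖T v‖ ‖y‖ ≤ e. Finally 2
    -- - 2|c| ≤ 2(1 - c²) = 2‖y‖² ≤ 8e².
    have h5 : ‖T v‖ ^ 2 * ‖y‖ ^ 2 ≤ ‖T v‖ * (e * ‖y‖) := by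
      rw [← hvy, ← inner_apply_eq_of_isMax hv hmax]
      exact (real_inner_le_norm _ _).trans (mul_le_mul_of_nonneg_left hTy (norm_nonneg _))
    have h6 : ‖y‖ ≤ 2 * e := by
      by_contra! h
      have hy0 : 0 < ‖y‖ := by linarith
      have h7 : ‖T v‖ * ‖y‖ * (‖T v‖ * ‖y‖) ≤ ‖T v‖ * ‖y‖ * e := by linarith
      have h8 := le_of_mul_le_mul_left h7 (by positivity)
      nlinarith
    have h9 := pow_le_pow_left₀ (norm_nonneg y) h6 2
    rw [hyy, ← sq_abs c] at h9
    nlinarith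

variable {d : ℕ}

theorem exists_isTopRightSingularVector [NeZero d] (M : Matrix (Fin d) (Fin d) ℝ) :
    ∃ v, IsTopRightSingularVector M v := by
  have hne : (Metric.sphere (0 : EuclideanSpace ℝ (Fin d)) 1).Nonempty :=
    NormedSpace.sphere_nonempty.2 zero_le_one
  obtain ⟨v, hv, hmax⟩ := (isCompact_sphere (0 : EuclideanSpace ℝ (Fin d)) 1).exists_isMaxOn hne
    (LinearMap.continuous_of_finiteDimensional (Matrix.toEuclideanLin M)).norm.continuousOn
  exact ⟨v, mem_sphere_zero_iff_norm.1 hv, fun w hw => hmax (mem_sphere_zero_iff_norm.2 hw)⟩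

theorem min_norm_sq_le_of_isTopRightSingularVector {p : ℝ} (hp : 0 < p)
    {M : Matrix (Fin d) (Fin d) ℝ} {x v : EuclideanSpace ℝ (Fin d)} (hx : ‖x‖ = 1)
    (hv : IsTopRightSingularVector M v) :
    min (‖v - x‖ ^ 2) (‖v + x‖ ^ 2) ≤
      8 * schattenNorm p (M - Matrix.vecMulVec (fun i => x i) fun i => x i) ^ 2 := by
  refine min_norm_sub_sq_le hx hv.1 hv.2 fun y => ?_
  have h := norm_apply_le_opSchattenNorm hp (Matrix.toEuclideanLin
    (M - Matrix.vecMulVec (fun i => x i) fun i => x i)) y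
  rwa [map_sub, LinearMap.sub_apply, toEuclideanLin_vecMulVec, ← map_sub] at h

end Decoder

/-! ### The competitor, the curvature bound and the reconstruction loss -/

section Main

open LinearMap

variable {d : ℕ} {μ : Measure (EuclideanSpace ℝ (Fin d))}

theorem ae_schattenError_le {p ε : ℝ} {k : ℕ} {A : Matrix (Fin k) (Fin d × Fin d) ℝ}
    {B : Matrix (Fin d × Fin d) (Fin k) ℝ}
    (h : ∀ᵐ x ∂μ, ∃ E : Matrix (Fin d) (Fin d) ℝ,
      unlift (B *ᵥ (A *ᵥ tensorSq x)) = Matrix.vecMulVec (fun i => x i) (fun i => x i) + E ∧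
      schattenNorm p E ≤ ε) : ∀ᵐ x ∂μ, schattenError p (B * A) x ≤ ε := by
  filter_upwards [h] with x ⟨E, hE, hle⟩
  refine le_trans (le_of_eq ?_) hle
  have : unlift ((B * A) *ᵥ tensorSq x - tensorSq x) = E := by
    rw [← Matrix.mulVec_mulVec, ← sub_eq_of_eq_add' hE]
    rfl
  rw [schattenError, this]

variable [IsProbabilityMeasure μ]

theorem dim_ne_zero_of_ae_norm_eq_one (hμ : ∀ᵐ x ∂μ, ‖x‖ = 1) : d ≠ 0 := by
  rintro rfl
  obtain ⟨x, hx⟩ := hμ.exists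
  rw [Subsingleton.elim x 0, norm_zero] at hx
  exact zero_ne_one hx

theorem schattenError_nonneg (p : ℝ) (R : Matrix (Fin d × Fin d) (Fin d × Fin d) ℝ)
    (x : EuclideanSpace ℝ (Fin d)) : 0 ≤ schattenError p R x :=
  opSchattenNorm_nonneg _ _

theorem schattenNorm_one_mul_le {n : Type*} [Fintype n] [DecidableEq n] {k : ℕ} {τ : ℝ}
    (A : Matrix (Fin k) n ℝ) (B : Matrix n (Fin k) ℝ)
    (h : ‖Matrix.toEuclideanCLM (𝕜 := ℝ) (B * A)‖ ≤ τ) : schattenNorm 1 (B * A) ≤ τ * k := by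
  refine opSchattenNorm_one_le ((norm_nonneg _).trans h) ?_ fun x => ?_
  · rw [finrank_range_toEuclideanLin]
    exact (Matrix.rank_mul_le_left B A).trans B.rank_le_card_width |>.trans_eq (Fintype.card_fin k)
  · exact (Matrix.toEuclideanCLM (𝕜 := ℝ) (B * A)).le_of_opNorm_le h x

theorem objective_le_sq {p ε : ℝ} (hp : 2 ≤ p) (hμ : ∀ᵐ x ∂μ, ‖x‖ = 1)
    {R : Matrix (Fin d × Fin d) (Fin d × Fin d) ℝ} (h : ∀ᵐ x ∂μ, schattenError p R x ≤ ε) :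
    objective p μ R ≤ ε ^ 2 := by
  have : ∫ x, schattenError p R x ^ 2 ∂μ ≤ ∫ _, ε ^ 2 ∂μ := by
    refine integral_mono_ae (integrable_schattenError_sq hμ hp R) (integrable_const _) ?_
    filter_upwards [h] with x hx
    exact pow_le_pow_left₀ (schattenError_nonneg p R x) hx 2
  simpa [objective] using this

/-- Nonnegativity of the variance, by integrating 2m s - m² ≤ s² with m the mean. -/
theorem integral_schattenError_sq_le_objective {p : ℝ} (hp : 2 ≤ p) (hμ : ∀ᵐ x ∂μ, ‖x‖ = 1)
    (R : Matrix (Fin d × Fin d) (Fin d × Fin d) ℝ) :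
    (∫ x, schattenError p R x ∂μ) ^ 2 ≤ objective p μ R := by
  have h1 := integrable_schattenError hμ hp R
  have h2 := integrable_schattenError_sq hμ hp R
  set m := ∫ x, schattenError p R x ∂μ with hm
  have h : ∫ x, 2 * m * schattenError p R x - m ^ 2 ∂μ ≤ objective p μ R :=
    integral_mono ((h1.const_mul _).sub (integrable_const _)) h2 fun x => by
      linarith [sq_nonneg (schattenError p R x - m)]
  rw [integral_sub (h1.const_mul _) (integrable_const _), integral_const_mul, ← hm] at h
  simp only [integral_const, probReal_univ, one_smul] at h
  linarith

/-- The operator norm is at most the trace norm, so feasible points are at most 2r apart in operator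
norm. -/
theorem liftedEnergy_smul_sub_le (hμ : ∀ᵐ x ∂μ, ‖x‖ = 1) {r : ℝ}
    {S V : Matrix (Fin d × Fin d) (Fin d × Fin d) ℝ} (hS : schattenNorm 1 S ≤ r)
    (hV : schattenNorm 1 V ≤ r) (γ : ℝ) :
    liftedEnergy μ (γ • (V - S)) ≤ γ ^ 2 * (4 * r ^ 2) := by
  have h := liftedEnergy_le (S := γ • (V - S)) (c := |γ| * (2 * r)) hμ fun z => by
    have hb {T : Matrix (Fin d × Fin d) (Fin d × Fin d) ℝ} (hT : schattenNorm 1 T ≤ r) :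
        ‖Matrix.toEuclideanLin T z‖ ≤ r * ‖z‖ :=
      (norm_apply_le_opSchattenNorm one_pos _ z).trans
        (mul_le_mul_of_nonneg_right hT (norm_nonneg z))
    rw [map_smul, LinearMap.smul_apply, norm_smul, map_sub, LinearMap.sub_apply, Real.norm_eq_abs,
      mul_assoc]
    refine mul_le_mul_of_nonneg_left ?_ (abs_nonneg γ)
    linarith [norm_sub_le (Matrix.toEuclideanLin V z) (Matrix.toEuclideanLin S z), hb hS, hb hV]
  rw [mul_pow, sq_abs] at h
  linarith

/-- An arbitrary choice of singular vectors need not make the loss measurable; `∫⁻` is monotone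
without measurability. -/
theorem lintegral_reconstructionLoss_le {p : ℝ} (hp : 2 ≤ p) (hμ : ∀ᵐ x ∂μ, ‖x‖ = 1) {k : ℕ}
    {A : Matrix (Fin k) (Fin d × Fin d) ℝ} {B : Matrix (Fin d × Fin d) (Fin k) ℝ}
    {g : (Fin k → ℝ) → EuclideanSpace ℝ (Fin d)} (hg : IsSpectralDecoder B g) :
    ∫⁻ x, ENNReal.ofReal (reconstructionLoss (encoder A) g x) ∂μ ≤
      ENNReal.ofReal (8 * objective p μ (B * A)) := by
  rw [objective, ← integral_const_mul,
    ofReal_integral_eq_lintegral_ofReal ((integrable_schattenError_sq hμ hp _).const_mul 8)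
      (Filter.Eventually.of_forall fun x => by positivity)]
  refine lintegral_mono_ae ?_
  filter_upwards [hμ] with x hx
  refine ENNReal.ofReal_le_ofReal ?_
  have h := min_norm_sq_le_of_isTopRightSingularVector (p := p) (by linarith) hx
    (hg (encoder A x))
  refine h.trans (le_of_eq ?_)
  rw [schattenError, ← Matrix.mulVec_mulVec]
  rfl

/-- Along a run on the autoencoding objective the optimality gap decays like `1 / t`. -/
theorem IsFrankWolfeRun.objective_le (hμ : ∀ᵐ x ∂μ, ‖x‖ = 1) {p P : ℝ} (hp : 2 ≤ p) (hpP : p ≤ P)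
    {r : ℝ} {R : ℕ → Matrix (Fin d × Fin d) (Fin d × Fin d) ℝ}
    (h : IsFrankWolfeRun (objective p μ) r R) {S : Matrix (Fin d × Fin d) (Fin d × Fin d) ℝ}
    (hS : schattenNorm 1 S ≤ r) (t : ℕ) :
    objective p μ (R (t + 1)) ≤
      objective p μ S + 16 * (8 + P * 2 ^ P) * r ^ 2 / ((t : ℝ) + 3) := by
  have hK : 0 ≤ 8 + P * 2 ^ P := by
    have : 0 ≤ P * 2 ^ P := mul_nonneg (by linarith) (by positivity)
    linarith
  have := h.sub_le (q := fun S => (8 + P * 2 ^ P) * liftedEnergy μ S)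
    (c := (8 + P * 2 ^ P) * (4 * r ^ 2)) (exists_hasFDerivAt_objective hμ hp hpP) (by positivity)
    (fun S V hS hV γ => by
      have := mul_le_mul_of_nonneg_left (liftedEnergy_smul_sub_le hμ hS hV γ) hK
      linarith) hS t
  rw [show 4 * ((8 + P * 2 ^ P) * (4 * r ^ 2)) = 16 * (8 + P * 2 ^ P) * r ^ 2 by ring] at this
  linarith

end Main

end SpectralAutoencoder

/-! ### The theorem -/

open SpectralAutoencoder in
theorem theorem9 (P : ℝ) :
    ∃ C : ℝ, 0 < C ∧ ∀ p : ℝ, 2 ≤ p → p ≤ P →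
      ∀ (d k : ℕ) (τ ε : ℝ) (μ : Measure (EuclideanSpace ℝ (Fin d))) [IsProbabilityMeasure μ],
        1 ≤ τ → (∀ᵐ x ∂μ, ‖x‖ = 1) → IsRegularlySpectralDecodable p τ k ε μ →
        -- Frank-Wolfe can be run on the objective, and every run is successful
        (∃ R, IsFrankWolfeRun (objective p μ) (τ * k) R) ∧
        ∀ R, IsFrankWolfeRun (objective p μ) (τ * k) R →
          ∀ δ : ℝ, 0 < δ → ∀ k' : ℕ, C * (k ^ 2 * τ ^ 2 / δ ^ 2) ≤ k' →
            -- the iterate after `k'` steps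
            (R k').rank ≤ k' ∧
            schattenNorm 1 (R k') ≤ τ * k ∧
            Integrable (fun x => schattenError p (R k') x ^ 2) μ ∧
            objective p μ (R k') ≤ ε ^ 2 + δ ^ 2 ∧
            Integrable (fun x => schattenError p (R k') x) μ ∧
            ∫ x, schattenError p (R k') x ∂μ ≤ ε + δ ∧
            -- the resulting spectral autoencoders of code length `k'`
            ∃ (A : Matrix (Fin k') (Fin d × Fin d) ℝ) (B : Matrix (Fin d × Fin d) (Fin k') ℝ),
              B * A = R k' ∧
              (∃ g, IsSpectralDecoder B g) ∧
              ∀ g, IsSpectralDecoder B g →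
                (encoder A, g) ∈ spectralAutoencoders d k' ∧
                ∫⁻ x, ENNReal.ofReal (reconstructionLoss (encoder A) g x) ∂μ
                  ≤ ENNReal.ofReal (8 * (ε ^ 2 + δ ^ 2)) := by
  rcases lt_or_ge P 2 with hP | hP
  · exact ⟨1, one_pos, fun p hp hpP => absurd (hp.trans hpP) (not_le.2 hP)⟩
  have hK : 0 < 8 + P * 2 ^ P := by
    have : 0 ≤ P * 2 ^ P := mul_nonneg (by linarith) (by positivity)
    linarith
  -- 16 = 4 · 4: one factor from the Frank–Wolfe rate, the other from the squared diameter (2r)².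
  refine ⟨16 * (8 + P * 2 ^ P), by positivity, ?_⟩
  intro p hp hpP d k τ ε μ _ hτ hμ ⟨A₀, B₀, hop, hdec⟩
  have : NeZero d := ⟨dim_ne_zero_of_ae_norm_eq_one hμ⟩
  have hr : 0 ≤ τ * k := by positivity
  have hae := ae_schattenError_le hdec
  have hε : 0 ≤ ε := by
    obtain ⟨x, hx⟩ := hae.exists
    exact (schattenError_nonneg _ _ _).trans hx
  have hobj := objective_le_sq hp hμ hae
  have hfeas := schattenNorm_one_mul_le A₀ B₀ hop
  refine ⟨exists_isFrankWolfeRun hr fun R =>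
    (exists_hasFDerivAt_objective hμ hp hpP R).imp fun _ h => h.1, ?_⟩
  intro R hR δ hδ k' hk'
  have hbound : 16 * (8 + P * 2 ^ P) * (τ * k) ^ 2 ≤ k' * δ ^ 2 := by
    rw [← mul_div_assoc, div_le_iff₀ (by positivity)] at hk'
    linarith
  -- With no steps taken the rate says nothing, but then the radius τk is 0 and both the start and
  -- the competitor vanish.
  have hzero (h : k' = 0) : k = 0 := by
    subst h
    rw [Nat.cast_zero, zero_mul] at hbound
    have h1 : (τ * k) ^ 2 = 0 :=
      le_antisymm (nonpos_of_mul_nonpos_right hbound (by positivity)) (sq_nonneg _)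
    simpa [show τ ≠ 0 by positivity] using h1
  obtain ⟨A, B, hBA⟩ := hR.exists_mul_eq (t := k') (by
    rcases eq_or_ne k' 0 with h | h
    · right
      simp [hzero h]
    · exact Or.inl h)
  have hf : objective p μ (R k') ≤ ε ^ 2 + δ ^ 2 := by
    rcases k' with _ | t
    · obtain rfl := hzero rfl
      have e : R 0 = B₀ * A₀ := by
        rw [← hBA]
        ext i j
        simp [Matrix.mul_apply]
      rw [e]
      nlinarith
    · refine (hR.objective_le hμ hp hpP hfeas t).trans (add_le_add hobj ?_)
      rw [div_le_iff₀ (by positivity)]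
      push_cast at hbound
      nlinarith [sq_nonneg δ]
  refine ⟨?_, hR.schattenNorm_le k', integrable_schattenError_sq hμ hp _, hf,
    integrable_schattenError hμ hp _, ?_, A, B, hBA, ?_, fun g hg => ⟨⟨A, B, rfl, hg⟩, ?_⟩⟩
  · rw [← hBA]
    exact (Matrix.rank_mul_le_left B A).trans B.rank_le_card_width |>.trans_eq (Fintype.card_fin k')
  · have h := integral_schattenError_sq_le_objective hp hμ (R k')
    -- Since ε, δ ≥ 0, ε² + δ² ≤ (ε + δ)².
    refine le_of_sq_le_sq (h.trans (hf.trans ?_)) (by positivity)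
    nlinarith
  · choose g hg using fun M => exists_isTopRightSingularVector (d := d) M
    exact ⟨fun y => g (unlift (B *ᵥ y)), fun y => hg _⟩
  · refine (lintegral_reconstructionLoss_le hp hμ hg).trans (ENNReal.ofReal_le_ofReal ?_)
    rw [hBA]
    linarith
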